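/- Let $(\mathcal C,\otimes,\mathbb 1)$ be a symmetric monoidal category with left and right unitors $\mathbf l_X:\mathbb 1\otimes X\to X$, $\mathbf r_X:X\otimes\mathbb 1\to X$. For a bimonoid $A$ write $\nabla_A,\eta_A,\Delta_A,\epsilon_A$ for its multiplication, unit, comultiplication and counit. **Integrals of a bimonoid.** A *normalized integral* of a bimonoid $A$ is a morphism $\sigma:\mathbb 1\to A$ with $\nabla_A(\sigma\otimes id_A)=\mathbf r_A(\sigma\otimes\epsilon_A)$, $\nabla_A(id_A\otimes\sigma)=\mathbf l_A(\epsilon_A\otimes\sigma)$ and $\epsilon_A\sigma=id_{\mathbb 1}$. Dually, a *normalized cointegral* of $A$ is a morphism $\sigma:A\to\mathbb 1$ with $(\sigma\otimes id_A)\Delta_A=(\sigma\otimes\eta_A)\mathbf r_A^{-1}$, $(id_A\otimes\sigma)\Delta_A=(\eta_A\otimes\sigma)\mathbf l_A^{-1}$ and $\sigma\eta_A=id_{\mathbb 1}$. **Integrals along a homomorphism.** Let $\xi:A\to B$ be a bimonoid homomorphism. A morphism $\mu:B\to A$ of $\mathcal C$ is a *right integral along $\xi$* if $$\nabla_A(\mu\otimes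 id_A)=\mu\nabla_B(id_B\otimes\xi),\qquad (\mu\otimes id_B)\Delta_B=(id_A\otimes\xi)\Delta_A\mu ,$$ a *left integral along $\xi$* if $$\nabla_A(id_A\otimes\mu)=\mu\nabla_B(\xi\otimes id_B),\qquad (id_B\otimes\mu)\Delta_B=(\xi\otimes id_A)\Delta_A\mu ,$$ and an *integral along $\xi$* if it is both. An integral $\mu$ along $\xi$ is *normalized* if $\xi\mu\xi=\xi$, and a *generator* if $\mu\xi\mu'=\mu'=\mu'\xi\mu$ for every $\mu':B\to A$ that is a right integral or a left integral along $\xi$. **Bistability.** Assume that $\mathcal C$ has all equalizers and coequalizers. A left action $(A,\alpha,X)$ consists of a bimonoid $A$, an object $X$ and an associative and unital morphism $\alpha:A\otimes X\to X$; its stabilized object $\alpha\backslash X$ is the coequalizer of $\alpha$ and the trivial action $\mathbf l_X(\epsilon_A\otimes id_X)$. The tensor product of $(A,\alpha,X)$ and $(A',\alpha',X')$ is the action of $A\otimes A'$ on $X\otimes X'$ obtained from $\alpha\otimes\alpha'$ and the symmetry, and there is a canonical morphism from its stabilized object to $(\alpha\backslash X)\otimes(\alpha'\backslash X')$. Right actions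 are treated in the same way. Dually, the stabilized object of a left or right coaction of a bimonoid is the equalizer of the coaction and the trivial coaction, with a canonical morphism from the tensor product of the stabilized objects of two coactions to the stabilized object of their tensor product. The monoidal structure of $\mathcal C$ is *stable* if forming stabilized objects of left actions and of right actions is strong monoidal, i.e. all these canonical morphisms for left actions and for right actions are isomorphisms; *costable* if the same holds for left and right coactions; and *bistable* if it is stable and costable. **Theorem.** Suppose that $\mathcal C$ has all equalizers and coequalizers, that its monoidal structure is bistable, and that the category $\mathsf{Hopf}^{\mathsf{bc}}(\mathcal C)$ of bicommutative (that is, commutative and cocommutative) Hopf monoids in $\mathcal C$ and bimonoid homomorphisms is abelian. Let $\xi:A\to B$ be a homomorphism of bicommutative Hopf monoids, and let $Ker(\xi)$ and $Cok(\xi)$ be its kernel and cokernel in $\mathsf{Hopf}^{\mathsf{bc}}(\mathcal C)$. Then there exists an integral along $\xi$ that is normalized and a generator if and only if $Ker(\xi)$ has a normalized integral and $Cok(\xi)$ has a normalized cointegral. Moreover, there is at most one normalized integral along $\xi$. -/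

import Mathlib

open CategoryTheory MonoidalCategory Limits

universe v u

namespace HopfIntegral

open scoped MonObj ComonObj

section Integrals

variable {C : Type u} [Category.{v} C] [MonoidalCategory C] [BraidedCategory C]

/-! ### Integrals and cointegrals of a bimonoid -/

/-- A (two-sided) integral of a bimonoid `A`. -/
structure IsIntegral {A : C} [BimonObj A] (σ : 𝟙_ C ⟶ A) : Prop where
  integral_mul : (σ ▷ A) ≫ μ[A] = (σ ⊗ₘ ε[A]) ≫ (ρ_ A).hom
  mul_integral : (A ◁ σ) ≫ μ[A] = (ε[A] ⊗ₘ σ) ≫ (λ_ A).hom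

/-- A normalized integral of a bimonoid `A`. -/
structure IsNormalizedIntegral {A : C} [BimonObj A] (σ : 𝟙_ C ⟶ A) : Prop
    extends IsIntegral σ where
  normalized : σ ≫ ε[A] = 𝟙 (𝟙_ C)

/-- A (two-sided) cointegral of a bimonoid `A`. -/
structure IsCointegral {A : C} [BimonObj A] (σ : A ⟶ 𝟙_ C) : Prop where
  comul_cointegral_left : Δ[A] ≫ (σ ▷ A) = (ρ_ A).inv ≫ (σ ⊗ₘ η[A])
  comul_cointegral_right : Δ[A] ≫ (A ◁ σ) = (λ_ A).inv ≫ (η[A] ⊗ₘ σ)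

/-- A normalized cointegral of a bimonoid `A`. -/
structure IsNormalizedCointegral {A : C} [BimonObj A] (σ : A ⟶ 𝟙_ C) : Prop
    extends IsCointegral σ where
  normalized : η[A] ≫ σ = 𝟙 (𝟙_ C)

/-! ### Integrals along a bimonoid homomorphism -/

/-- `m : B ⟶ A` is a right integral along the bimonoid homomorphism `ξ : A ⟶ B`. -/
structure IsRightIntegralAlong {A B : C} [BimonObj A] [BimonObj B] (ξ : A ⟶ B) [IsBimonHom ξ]
    (m : B ⟶ A) : Prop where
  mul : (m ▷ A) ≫ μ[A] = (B ◁ ξ) ≫ μ[B] ≫ m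
  comul : Δ[B] ≫ (m ▷ B) = m ≫ Δ[A] ≫ (A ◁ ξ)

/-- `m : B ⟶ A` is a left integral along the bimonoid homomorphism `ξ : A ⟶ B`. -/
structure IsLeftIntegralAlong {A B : C} [BimonObj A] [BimonObj B] (ξ : A ⟶ B) [IsBimonHom ξ]
    (m : B ⟶ A) : Prop where
  mul : (A ◁ m) ≫ μ[A] = (ξ ▷ B) ≫ μ[B] ≫ m
  comul : Δ[B] ≫ (B ◁ m) = m ≫ Δ[A] ≫ (ξ ▷ A)

/-- `m : B ⟶ A` is an integral along `ξ : A ⟶ B`: a right and a left integral along `ξ`. -/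
structure IsIntegralAlong {A B : C} [BimonObj A] [BimonObj B] (ξ : A ⟶ B) [IsBimonHom ξ]
    (m : B ⟶ A) : Prop where
  right : IsRightIntegralAlong ξ m
  left : IsLeftIntegralAlong ξ m

/-- A normalized integral along `ξ`. -/
structure IsNormalizedIntegralAlong {A B : C} [BimonObj A] [BimonObj B] (ξ : A ⟶ B)
    [IsBimonHom ξ] (m : B ⟶ A) : Prop extends IsIntegralAlong ξ m where
  normalized : ξ ≫ m ≫ ξ = ξ

/-- A generator integral along `ξ`: every right or left integral along `ξ` is reproduced by
composing with it through `ξ` on either side. -/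
structure IsGeneratorIntegralAlong {A B : C} [BimonObj A] [BimonObj B] (ξ : A ⟶ B)
    [IsBimonHom ξ] (m : B ⟶ A) : Prop extends IsIntegralAlong ξ m where
  comp_generator : ∀ m' : B ⟶ A, IsRightIntegralAlong ξ m' ∨ IsLeftIntegralAlong ξ m' →
    m' ≫ ξ ≫ m = m'
  generator_comp : ∀ m' : B ⟶ A, IsRightIntegralAlong ξ m' ∨ IsLeftIntegralAlong ξ m' →
    m ≫ ξ ≫ m' = m'

end Integrals

section Actions

variable {C : Type u} [Category.{v} C] [MonoidalCategory C] [BraidedCategory C]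

/-! ### Actions and coactions of bimonoids -/

/-- `(A, a, X)` is a left action. -/
structure IsLeftAction {A X : C} [BimonObj A] (a : A ⊗ X ⟶ X) : Prop where
  assoc : (μ[A] ▷ X) ≫ a = (α_ A A X).hom ≫ (A ◁ a) ≫ a
  unit : (η[A] ▷ X) ≫ a = (λ_ X).hom

/-- `(X, a, A)` is a right action. -/
structure IsRightAction {A X : C} [BimonObj A] (a : X ⊗ A ⟶ X) : Prop where
  assoc : (X ◁ μ[A]) ≫ a = (α_ X A A).inv ≫ (a ▷ A) ≫ a
  unit : (X ◁ η[A]) ≫ a = (ρ_ X).hom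

/-- `(A, b, Y)` is a left coaction. -/
structure IsLeftCoaction {A Y : C} [BimonObj A] (b : Y ⟶ A ⊗ Y) : Prop where
  coassoc : b ≫ (Δ[A] ▷ Y) = b ≫ (A ◁ b) ≫ (α_ A A Y).inv
  counit : b ≫ (ε[A] ▷ Y) = (λ_ Y).inv

/-- `(Y, b, A)` is a right coaction. -/
structure IsRightCoaction {A Y : C} [BimonObj A] (b : Y ⟶ Y ⊗ A) : Prop where
  coassoc : b ≫ (Y ◁ Δ[A]) = b ≫ (b ▷ A) ≫ (α_ Y A A).hom
  counit : b ≫ (Y ◁ ε[A]) = (ρ_ Y).inv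

/-- The trivial left action of `A` on `X`. -/
def trivLeftAct (A X : C) [ComonObj A] : A ⊗ X ⟶ X := (ε[A] ▷ X) ≫ (λ_ X).hom

/-- The trivial right action of `A` on `X`. -/
def trivRightAct (A X : C) [ComonObj A] : X ⊗ A ⟶ X := (X ◁ ε[A]) ≫ (ρ_ X).hom

/-- The trivial left coaction of `A` on `Y`. -/
def trivLeftCoact (A Y : C) [MonObj A] : Y ⟶ A ⊗ Y := (λ_ Y).inv ≫ (η[A] ▷ Y)

/-- The trivial right coaction of `A` on `Y`. -/
def trivRightCoact (A Y : C) [MonObj A] : Y ⟶ Y ⊗ A := (ρ_ Y).inv ≫ (Y ◁ η[A])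

/-- The tensor product of two left actions, an action of `A ⊗ A'` on `X ⊗ X'`. -/
def tensorLeftAct {A A' X X' : C} (a : A ⊗ X ⟶ X) (a' : A' ⊗ X' ⟶ X') :
    (A ⊗ A') ⊗ (X ⊗ X') ⟶ X ⊗ X' := tensorμ A A' X X' ≫ (a ⊗ₘ a')

/-- The tensor product of two right actions, an action of `A ⊗ A'` on `X ⊗ X'`. -/
def tensorRightAct {A A' X X' : C} (a : X ⊗ A ⟶ X) (a' : X' ⊗ A' ⟶ X') :
    (X ⊗ X') ⊗ (A ⊗ A') ⟶ X ⊗ X' := tensorμ X X' A A' ≫ (a ⊗ₘ a')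

/-- The tensor product of two left coactions, a coaction of `A ⊗ A'` on `Y ⊗ Y'`. -/
def tensorLeftCoact {A A' Y Y' : C} (b : Y ⟶ A ⊗ Y) (b' : Y' ⟶ A' ⊗ Y') :
    Y ⊗ Y' ⟶ (A ⊗ A') ⊗ (Y ⊗ Y') := (b ⊗ₘ b') ≫ tensorμ A Y A' Y'

/-- The tensor product of two right coactions, a coaction of `A ⊗ A'` on `Y ⊗ Y'`. -/
def tensorRightCoact {A A' Y Y' : C} (b : Y ⟶ Y ⊗ A) (b' : Y' ⟶ Y' ⊗ A') :
    Y ⊗ Y' ⟶ (Y ⊗ Y') ⊗ (A ⊗ A') := (b ⊗ₘ b') ≫ tensorμ Y A Y' A'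

/-! The tensor product of trivial (co)actions is the trivial (co)action. -/

theorem tensorLeftAct_triv (A A' X X' : C) [ComonObj A] [ComonObj A'] :
    tensorLeftAct (trivLeftAct A X) (trivLeftAct A' X') = trivLeftAct (A ⊗ A') (X ⊗ X') := by
  have h := tensor_left_unitality X X'
  simp only [tensorLeftAct, trivLeftAct, Comon.tensorObj_counit, comp_whiskerRight,
    Category.assoc, h, ← tensorHom_comp_tensorHom]
  rw [← tensorμ_natural_left_assoc, ← comp_whiskerRight_assoc (λ_ (𝟙_ C)).hom]
  simp

theorem tensorRightAct_triv (A A' X X' : C) [ComonObj A] [ComonObj A'] :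
    tensorRightAct (trivRightAct A X) (trivRightAct A' X') =
      trivRightAct (A ⊗ A') (X ⊗ X') := by
  have h := tensor_right_unitality X X'
  simp only [tensorRightAct, trivRightAct, Comon.tensorObj_counit, MonoidalCategory.whiskerLeft_comp,
    Category.assoc, h, ← tensorHom_comp_tensorHom]
  rw [← tensorμ_natural_right_assoc,
    ← MonoidalCategory.whiskerLeft_comp_assoc _ (λ_ (𝟙_ C)).hom]
  simp

theorem tensorLeftCoact_triv (A A' Y Y' : C) [MonObj A] [MonObj A'] :
    tensorLeftCoact (trivLeftCoact A Y) (trivLeftCoact A' Y') =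
      trivLeftCoact (A ⊗ A') (Y ⊗ Y') := by
  have h : ((λ_ Y).inv ⊗ₘ (λ_ Y').inv) ≫ tensorμ (𝟙_ C) Y (𝟙_ C) Y' =
      (λ_ (Y ⊗ Y')).inv ≫ ((λ_ (𝟙_ C)).inv ▷ (Y ⊗ Y')) := by
    rw [← cancel_epi ((λ_ Y).hom ⊗ₘ (λ_ Y').hom), tensorHom_comp_tensorHom_assoc,
      leftUnitor_monoidal]
    simp
  simp only [tensorLeftCoact, trivLeftCoact, MonObj.tensorObj.one_def, Category.assoc,
    ← tensorHom_comp_tensorHom, ← tensorHom_id]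
  rw [tensorμ_natural, reassoc_of% h, id_tensorHom_id, tensorHom_id, tensorHom_id,
    comp_whiskerRight]

theorem tensorRightCoact_triv (A A' Y Y' : C) [MonObj A] [MonObj A'] :
    tensorRightCoact (trivRightCoact A Y) (trivRightCoact A' Y') =
      trivRightCoact (A ⊗ A') (Y ⊗ Y') := by
  have h : ((ρ_ Y).inv ⊗ₘ (ρ_ Y').inv) ≫ tensorμ Y (𝟙_ C) Y' (𝟙_ C) =
      (ρ_ (Y ⊗ Y')).inv ≫ ((Y ⊗ Y') ◁ (λ_ (𝟙_ C)).inv) := by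
    rw [← cancel_epi ((ρ_ Y).hom ⊗ₘ (ρ_ Y').hom), tensorHom_comp_tensorHom_assoc,
      rightUnitor_monoidal]
    simp
  simp only [tensorRightCoact, trivRightCoact, MonObj.tensorObj.one_def, Category.assoc,
    ← tensorHom_comp_tensorHom, ← id_tensorHom]
  rw [tensorμ_natural, reassoc_of% h, id_tensorHom_id, id_tensorHom, id_tensorHom,
    MonoidalCategory.whiskerLeft_comp]

end Actions

section Stability

variable {C : Type u} [Category.{v} C] [MonoidalCategory C] [BraidedCategory C]

/-! ### Stabilized objects and (co, bi)stable monoidal structures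

The stabilized object of an action is the coequalizer of the action and the trivial action; the
stabilized object of a coaction is the equalizer of the coaction and the trivial coaction. -/

section Coequalizers

variable [HasCoequalizers C]

/-- The stabilized object of a left action. -/
noncomputable abbrev leftStab {A X : C} [ComonObj A] (a : A ⊗ X ⟶ X) : C :=
  coequalizer a (trivLeftAct A X)

/-- The stabilized object of a right action. -/
noncomputable abbrev rightStab {A X : C} [ComonObj A] (a : X ⊗ A ⟶ X) : C :=
  coequalizer a (trivRightAct A X)

/-- The canonical morphism from the stabilized object of a tensor product of left actions to the
tensor product of the stabilized objects. -/
noncomputable def leftStabComparison {A A' X X' : C} [ComonObj A] [ComonObj A']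
    (a : A ⊗ X ⟶ X) (a' : A' ⊗ X' ⟶ X') :
    leftStab (tensorLeftAct a a') ⟶ leftStab a ⊗ leftStab a' :=
  coequalizer.desc
    (coequalizer.π a (trivLeftAct A X) ⊗ₘ coequalizer.π a' (trivLeftAct A' X')) (by
      rw [← tensorLeftAct_triv]
      simp only [tensorLeftAct, Category.assoc, tensorHom_comp_tensorHom]
      rw [coequalizer.condition a, coequalizer.condition a'])

/-- The canonical morphism from the stabilized object of a tensor product of right actions to the
tensor product of the stabilized objects. -/
noncomputable def rightStabComparison {A A' X X' : C} [ComonObj A] [ComonObj A']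
    (a : X ⊗ A ⟶ X) (a' : X' ⊗ A' ⟶ X') :
    rightStab (tensorRightAct a a') ⟶ rightStab a ⊗ rightStab a' :=
  coequalizer.desc
    (coequalizer.π a (trivRightAct A X) ⊗ₘ coequalizer.π a' (trivRightAct A' X')) (by
      rw [← tensorRightAct_triv]
      simp only [tensorRightAct, Category.assoc, tensorHom_comp_tensorHom]
      rw [coequalizer.condition a, coequalizer.condition a'])

variable (C) in
/-- The monoidal structure of `C` is stable: taking stabilized objects of left actions, and of
right actions, is a strong monoidal functor, that is, its canonical comonoidal structure
morphisms are isomorphisms. (The structure morphism for the unit is a morphism out of the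
coequalizer of two equal endomorphisms of the unit, and is always an isomorphism.) -/
structure IsStable : Prop where
  left : ∀ {A A' X X' : C} [BimonObj A] [BimonObj A'] (a : A ⊗ X ⟶ X) (a' : A' ⊗ X' ⟶ X'),
    IsLeftAction a → IsLeftAction a' → IsIso (leftStabComparison a a')
  right : ∀ {A A' X X' : C} [BimonObj A] [BimonObj A'] (a : X ⊗ A ⟶ X) (a' : X' ⊗ A' ⟶ X'),
    IsRightAction a → IsRightAction a' → IsIso (rightStabComparison a a')

end Coequalizers

section Equalizers

variable [HasEqualizers C]

/-- The stabilized object of a left coaction. -/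
noncomputable abbrev leftCostab {A Y : C} [MonObj A] (b : Y ⟶ A ⊗ Y) : C :=
  equalizer b (trivLeftCoact A Y)

/-- The stabilized object of a right coaction. -/
noncomputable abbrev rightCostab {A Y : C} [MonObj A] (b : Y ⟶ Y ⊗ A) : C :=
  equalizer b (trivRightCoact A Y)

/-- The canonical morphism from the tensor product of the stabilized objects of left coactions to
the stabilized object of their tensor product. -/
noncomputable def leftCostabComparison {A A' Y Y' : C} [MonObj A] [MonObj A']
    (b : Y ⟶ A ⊗ Y) (b' : Y' ⟶ A' ⊗ Y') :
    leftCostab b ⊗ leftCostab b' ⟶ leftCostab (tensorLeftCoact b b') :=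
  equalizer.lift
    (equalizer.ι b (trivLeftCoact A Y) ⊗ₘ equalizer.ι b' (trivLeftCoact A' Y')) (by
      rw [← tensorLeftCoact_triv]
      simp only [tensorLeftCoact, tensorHom_comp_tensorHom_assoc]
      rw [equalizer.condition b, equalizer.condition b'])

/-- The canonical morphism from the tensor product of the stabilized objects of right coactions to
the stabilized object of their tensor product. -/
noncomputable def rightCostabComparison {A A' Y Y' : C} [MonObj A] [MonObj A']
    (b : Y ⟶ Y ⊗ A) (b' : Y' ⟶ Y' ⊗ A') :
    rightCostab b ⊗ rightCostab b' ⟶ rightCostab (tensorRightCoact b b') :=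
  equalizer.lift
    (equalizer.ι b (trivRightCoact A Y) ⊗ₘ equalizer.ι b' (trivRightCoact A' Y')) (by
      rw [← tensorRightCoact_triv]
      simp only [tensorRightCoact, tensorHom_comp_tensorHom_assoc]
      rw [equalizer.condition b, equalizer.condition b'])

variable (C) in
/-- The monoidal structure of `C` is costable: taking stabilized objects of left coactions, and of
right coactions, is a strong monoidal functor, that is, its canonical monoidal structure
morphisms are isomorphisms. (The one for the unit always is.) -/
structure IsCostable : Prop where
  left : ∀ {A A' Y Y' : C} [BimonObj A] [BimonObj A'] (b : Y ⟶ A ⊗ Y) (b' : Y' ⟶ A' ⊗ Y'),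
    IsLeftCoaction b → IsLeftCoaction b' → IsIso (leftCostabComparison b b')
  right : ∀ {A A' Y Y' : C} [BimonObj A] [BimonObj A'] (b : Y ⟶ Y ⊗ A) (b' : Y' ⟶ Y' ⊗ A'),
    IsRightCoaction b → IsRightCoaction b' → IsIso (rightCostabComparison b b')

end Equalizers

variable (C) in
/-- The monoidal structure of `C` is bistable. -/
structure IsBistable [HasEqualizers C] [HasCoequalizers C] : Prop where
  stable : IsStable C
  costable : IsCostable C

end Stability

section Hopf

variable (C : Type u) [Category.{v} C] [MonoidalCategory C] [BraidedCategory C]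

/-! ### Bicommutative Hopf monoids -/

/-- A Hopf monoid is bicommutative if it is commutative and cocommutative. -/
def isBicommutative : ObjectProperty (Hopf C) :=
  fun A => IsCommMonObj A.X ∧ IsCommComonObj A.X

/-- The category of bicommutative Hopf monoids in `C` and bimonoid homomorphisms, a full
subcategory of the category of Hopf monoids. -/
abbrev BicommHopf := (isBicommutative C).FullSubcategory

variable {C}

/-- The underlying object of a bicommutative Hopf monoid. -/
abbrev BicommHopf.X (A : BicommHopf C) : C := A.obj.X

instance (A : BicommHopf C) : IsCommMonObj A.X := A.property.1

instance (A : BicommHopf C) : IsCommComonObj A.X := A.property.2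

/-- The underlying morphism of a homomorphism of bicommutative Hopf monoids. -/
def BicommHopf.toHom {A B : BicommHopf C} (ξ : A ⟶ B) : A.X ⟶ B.X := ξ.hom.hom.hom.hom

instance {A B : BicommHopf C} (ξ : A ⟶ B) : IsBimonHom (BicommHopf.toHom ξ) where
  one_hom := ξ.hom.hom.hom.isMonHom_hom.one_hom
  mul_hom := ξ.hom.hom.hom.isMonHom_hom.mul_hom
  hom_counit := congrArg Mon.Hom.hom ξ.hom.hom.isComonHom_hom.hom_counit
  hom_comul := congrArg Mon.Hom.hom ξ.hom.hom.isComonHom_hom.hom_comul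

end Hopf

end HopfIntegral

namespace HopfIntegral

open scoped MonObj ComonObj

/-! ### Homomorphisms of bicommutative Hopf monoids; bistability as exactness of tensoring. -/

section

variable {C : Type u} [Category.{v} C] [MonoidalCategory C] [BraidedCategory C]

/-! Factor `ξ` as `p : A ⟶ I` followed by `i : I ⟶ B`, where `p` is the cokernel of the kernel `k :
K ⟶ A` and `i` is the kernel of the cokernel `q : B ⟶ Q`. Bistability makes these abstract
(co)kernels concrete: a cokernel is the coequalizer in `C` of a translation action and the trivial
one, a kernel is the dual equalizer, and both survive tensoring with any object
(`BicommHopf.isStableCoeq_cokernel`, `BicommHopf.isStableEq_kernel`).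

Given a normalized integral `t` of `K`, put `s = k(t)`. Multiplication by `s` absorbs `K`, so it
factors through `p` as a map `m : I ⟶ A`, which is an integral along `p` and a section of `p`.
Dually, a normalized cointegral of `Q` contracts the comultiplication of `B`; the contraction
factors through `i` as an integral `n : B ⟶ I` along `i` that retracts `i`. Then `n ≫ m` is a
normalized generator (`exists_isNormalizedIntegralAlong`).

Conversely, a normalized integral `m` along `ξ` yields the integral `η ≫ m`, which is coinvariant
and so lies in `K`, and the cointegral `m ≫ ε`, which is invariant and so descends to `Q`. Only
normalization enters, so every normalized integral forces a generator to exist; sandwiching between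
copies of the generator shows that the two agree, whence uniqueness. -/

/-- A bimonoid homomorphism between bicommutative Hopf monoids, as a morphism of `BicommHopf C`. -/
def BicommHopf.ofHom {A B : BicommHopf C} (f : A.X ⟶ B.X) [IsBimonHom f] : A ⟶ B :=
  ObjectProperty.homMk (InducedCategory.homMk
    (Comon.Hom.mk' (M := Hopf.toBimon A.obj) (N := Hopf.toBimon B.obj)
      (Mon.Hom.mk (M := ⟨A.X⟩) (N := ⟨B.X⟩) f)
      (Mon.Hom.ext (IsComonHom.hom_counit f)) (Mon.Hom.ext (IsComonHom.hom_comul f))))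

@[simp]
theorem BicommHopf.toHom_ofHom {A B : BicommHopf C} (f : A.X ⟶ B.X) [IsBimonHom f] :
    toHom (ofHom f) = f := rfl

@[simp]
theorem BicommHopf.toHom_comp {A B D : BicommHopf C} (f : A ⟶ B) (g : B ⟶ D) :
    toHom (f ≫ g) = toHom f ≫ toHom g := rfl

@[simp]
theorem BicommHopf.toHom_id (A : BicommHopf C) : toHom (𝟙 A) = 𝟙 A.X := rfl

theorem BicommHopf.hom_ext {A B : BicommHopf C} {f g : A ⟶ B} (h : toHom f = toHom g) : f = g :=
  ObjectProperty.hom_ext _ (InducedCategory.hom_ext (Comon.Hom.ext (Mon.Hom.ext h)))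

instance isBimonHom_counit_one (A B : C) [BimonObj A] [BimonObj B] :
    IsBimonHom (ε[A] ≫ η[B]) where
  one_hom := by simp
  mul_hom := by simp [← tensorHom_comp_tensorHom, unitors_equal]
  hom_counit := by simp
  hom_comul := by
    simp [← tensorHom_comp_tensorHom, unitors_inv_equal, MonObj.tensorObj.one_def]

/-- Zero morphisms are given abstractly. They absorb the trivial endomorphism of `A`, and as
homomorphisms they preserve the unit; this pins them down. -/
theorem BicommHopf.toHom_zero [HasZeroMorphisms (BicommHopf C)] (A B : BicommHopf C) :
    toHom (0 : A ⟶ B) = ε[A.X] ≫ η[B.X] := by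
  have h : ofHom (ε[A.X] ≫ η[A.X]) ≫ (0 : A ⟶ B) = 0 := comp_zero
  rw [← h, toHom_comp, toHom_ofHom]
  simp

theorem BicommHopf.isIso_toHom {A B : BicommHopf C} (f : A ⟶ B) [IsIso f] :
    IsIso (toHom f) :=
  ⟨toHom (inv f), by rw [← toHom_comp]; simp, by rw [← toHom_comp]; simp⟩

/-- The trivial bimonoid structure on the monoidal unit. -/
noncomputable abbrev bimonObjUnit : BimonObj (𝟙_ C) :=
  inferInstanceAs (BimonObj (Bimon.trivial C).X.X)

/-- This action coincides with the trivial one, so its stabilized object is `Y` itself. It lets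
strong monoidality of stabilization say something about tensoring with an arbitrary object. -/
theorem isLeftAction_unit (Y : C) :
    letI : BimonObj (𝟙_ C) := bimonObjUnit
    IsLeftAction (A := 𝟙_ C) (λ_ Y).hom := by
  let : BimonObj (𝟙_ C) := bimonObjUnit
  constructor
  · change (λ_ (𝟙_ C)).hom ▷ _ ≫ _ = _
    monoidal
  · change (𝟙 (𝟙_ C)) ▷ _ ≫ _ = _
    monoidal
theorem isLeftCoaction_unit (Y : C) :
    letI : BimonObj (𝟙_ C) := bimonObjUnit
    IsLeftCoaction (A := 𝟙_ C) (λ_ Y).inv := by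
  let : BimonObj (𝟙_ C) := bimonObjUnit
  constructor
  · change _ ≫ (λ_ (𝟙_ C)).inv ▷ _ = _
    monoidal
  · change _ ≫ (𝟙 (𝟙_ C)) ▷ _ = _
    monoidal

/-- The translation action of `A` on `B` through `f`; its stabilized object will be the cokernel of
`f`. -/
theorem isLeftAction_hom {A B : C} [BimonObj A] [BimonObj B] (f : A ⟶ B) [IsBimonHom f] :
    IsLeftAction (f ▷ B ≫ μ[B]) := by
  constructor
  · rw [← comp_whiskerRight_assoc, IsMonHom.mul_hom, comp_whiskerRight_assoc, MonObj.mul_assoc]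
    simp only [← id_tensorHom, ← tensorHom_id, tensorHom_comp_tensorHom_assoc,
      associator_naturality_assoc, Category.id_comp, Category.comp_id]
  · simp [← comp_whiskerRight_assoc]

theorem isLeftCoaction_hom {A B : C} [BimonObj A] [BimonObj B] (f : A ⟶ B) [IsBimonHom f] :
    IsLeftCoaction (Δ[A] ≫ f ▷ A) := by
  constructor
  · rw [Category.assoc, ← comp_whiskerRight, IsComonHom.hom_comul, comp_whiskerRight,
      ComonObj.comul_assoc_flip_assoc]
    simp only [← id_tensorHom, ← tensorHom_id, tensorHom_comp_tensorHom_assoc, Category.assoc,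
      ← associator_inv_naturality, Category.id_comp, Category.comp_id]
  · simp [← comp_whiskerRight]

/-- `π` is a coequalizer of `f` and `g`, and stays so after tensoring with any object. -/
structure IsStableCoeq {W X Q : C} (f g : W ⟶ X) (π : X ⟶ Q) : Prop where
  condition : f ≫ π = g ≫ π
  epi_whiskerRight : ∀ Y : C, Epi (π ▷ Y)
  exists_desc : ∀ {Y Z : C} (h : X ⊗ Y ⟶ Z), f ▷ Y ≫ h = g ▷ Y ≫ h → ∃ l, π ▷ Y ≫ l = h

/-- `i` is an equalizer of `f` and `g`, and stays so after tensoring with any object. -/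
structure IsStableEq {W X K : C} (f g : X ⟶ W) (i : K ⟶ X) : Prop where
  condition : i ≫ f = i ≫ g
  mono_whiskerRight : ∀ Y : C, Mono (i ▷ Y)
  exists_lift : ∀ {Y Z : C} (h : Z ⟶ X ⊗ Y), h ≫ f ▷ Y = h ≫ g ▷ Y → ∃ l, l ≫ i ▷ Y = h

/-- Stability is applied to `a` and the action of the unit on `Y`. Up to unitors their tensor
product is `a ▷ Y`, so the invertible comparison identifies the projection of the tensor action with
`π ▷ Y`. -/
theorem IsStable.isStableCoeq [HasCoequalizers C] (hC : IsStable C) {A X : C} [BimonObj A]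
    {a : A ⊗ X ⟶ X} (ha : IsLeftAction a) :
    IsStableCoeq a (trivLeftAct A X) (coequalizer.π a (trivLeftAct A X)) := by
  let : BimonObj (𝟙_ C) := bimonObjUnit
  have triv : ∀ Y, trivLeftAct (𝟙_ C) Y = (λ_ Y).hom := fun Y => by
    change 𝟙 (𝟙_ C) ▷ Y ≫ _ = _
    simp
  have hiso : ∀ Y, IsIso (coequalizer.π (λ_ Y).hom (trivLeftAct (𝟙_ C) Y)) := fun Y => by
    rw [triv]; infer_instance
  have key : ∀ Y, coequalizer.π _ _ ≫ leftStabComparison a (λ_ Y).hom =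
      coequalizer.π a (trivLeftAct A X) ▷ Y ≫
        _ ◁ coequalizer.π (λ_ Y).hom (trivLeftAct (𝟙_ C) Y) := fun Y => by
    simp [leftStabComparison, MonoidalCategory.tensorHom_def]
  have hcomp : ∀ Y, IsIso (leftStabComparison a (λ_ Y).hom) := fun Y =>
    hC.left a _ ha (isLeftAction_unit Y)
  have key' : ∀ Y, coequalizer.π a (trivLeftAct A X) ▷ Y =
      (coequalizer.π _ _ ≫ leftStabComparison a (λ_ Y).hom) ≫
        inv (_ ◁ coequalizer.π (λ_ Y).hom (trivLeftAct (𝟙_ C) Y)) := fun Y => by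
    rw [key]; simp
  refine ⟨coequalizer.condition _ _, fun Y => ?_, fun {Y Z} h hh => ?_⟩
  · rw [key']; infer_instance
  · refine ⟨_ ◁ coequalizer.π (λ_ Y).hom (trivLeftAct (𝟙_ C) Y) ≫
      inv (leftStabComparison a (λ_ Y).hom) ≫ coequalizer.desc h ?_, ?_⟩
    -- The given and the trivial action differ from their whiskered forms by the same reindexing, so
    -- `hh` transfers to the tensor actions.
    · have aux : ∀ b : A ⊗ X ⟶ X, tensorLeftAct b (λ_ Y).hom =
        (tensorμ A (𝟙_ C) X Y ≫ (A ⊗ X) ◁ (λ_ Y).hom) ≫ b ▷ Y := fun b => by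
        simp [tensorLeftAct, MonoidalCategory.tensorHom_def', -tensor_whiskerLeft]
      rw [← tensorLeftAct_triv, triv, aux, aux, Category.assoc, hh, ← Category.assoc]
    · rw [key']
      simp

theorem IsCostable.isStableEq [HasEqualizers C] (hC : IsCostable C) {A X : C} [BimonObj A]
    {a : X ⟶ A ⊗ X} (ha : IsLeftCoaction a) :
    IsStableEq a (trivLeftCoact A X) (equalizer.ι a (trivLeftCoact A X)) := by
  let : BimonObj (𝟙_ C) := bimonObjUnit
  have triv : ∀ Y, trivLeftCoact (𝟙_ C) Y = (λ_ Y).inv := fun Y => by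
    change _ ≫ 𝟙 (𝟙_ C) ▷ Y = _
    simp
  have hiso : ∀ Y, IsIso (equalizer.ι (λ_ Y).inv (trivLeftCoact (𝟙_ C) Y)) := fun Y => by
    rw [triv]; infer_instance
  have key : ∀ Y, leftCostabComparison a (λ_ Y).inv ≫ equalizer.ι _ _ =
      _ ◁ equalizer.ι (λ_ Y).inv (trivLeftCoact (𝟙_ C) Y) ≫
      equalizer.ι a (trivLeftCoact A X) ▷ Y := fun Y => by
    simp [leftCostabComparison, MonoidalCategory.tensorHom_def']
  have hcomp : ∀ Y, IsIso (leftCostabComparison a (λ_ Y).inv) := fun Y =>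
    hC.left a _ ha (isLeftCoaction_unit Y)
  have key' : ∀ Y, equalizer.ι a (trivLeftCoact A X) ▷ Y =
      inv (_ ◁ equalizer.ι (λ_ Y).inv (trivLeftCoact (𝟙_ C) Y)) ≫
        leftCostabComparison a (λ_ Y).inv ≫ equalizer.ι _ _ := fun Y => by
    rw [key]; simp
  refine ⟨equalizer.condition _ _, fun Y => ?_, fun {Y Z} h hh => ?_⟩
  · rw [key']; infer_instance
  · refine ⟨equalizer.lift h ?_ ≫ inv (leftCostabComparison a (λ_ Y).inv) ≫
      _ ◁ equalizer.ι (λ_ Y).inv (trivLeftCoact (𝟙_ C) Y), ?_⟩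
    · have aux : ∀ b : X ⟶ A ⊗ X, tensorLeftCoact b (λ_ Y).inv =
        b ▷ Y ≫ ((A ⊗ X) ◁ (λ_ Y).inv ≫ tensorμ A X (𝟙_ C) Y) := fun b => by
        simp [tensorLeftCoact, MonoidalCategory.tensorHom_def, -tensor_whiskerLeft]
      rw [← tensorLeftCoact_triv, triv, aux, aux, ← Category.assoc, hh, Category.assoc]
    · rw [key']
      simp
end

/-! ### Hopf structures on quotients and subobjects. -/

section

variable {C : Type u} [Category.{v} C] [MonoidalCategory C]

theorem epi_of_epi_whiskerRight_unit {X Y : C} (p : X ⟶ Y) [Epi (p ▷ 𝟙_ C)] : Epi p := by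
  have h : p = (ρ_ X).inv ≫ p ▷ 𝟙_ C ≫ (ρ_ Y).hom := by simp
  rw [h]
  infer_instance

theorem mono_of_mono_whiskerRight_unit {X Y : C} (i : X ⟶ Y) [Mono (i ▷ 𝟙_ C)] : Mono i := by
  have h : i = (ρ_ X).inv ≫ i ▷ 𝟙_ C ≫ (ρ_ Y).hom := by simp
  rw [h]
  infer_instance

variable [BraidedCategory C]

theorem epi_whiskerLeft_of_epi_whiskerRight {X Y : C} (p : X ⟶ Y) (Z : C) [Epi (p ▷ Z)] :
    Epi (Z ◁ p) := by
  have h : Z ◁ p = (β_ Z X).hom ≫ p ▷ Z ≫ (β_ Z Y).inv := by simp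
  rw [h]
  infer_instance

theorem mono_whiskerLeft_of_mono_whiskerRight {X Y : C} (i : X ⟶ Y) (Z : C) [Mono (i ▷ Z)] :
    Mono (Z ◁ i) := by
  have h : Z ◁ i = (β_ Z X).hom ≫ i ▷ Z ≫ (β_ Z Y).inv := by simp
  rw [h]
  infer_instance

theorem epi_tensorHom_of_epi_whiskerRight {X Y X' Y' : C} (p : X ⟶ Y) (p' : X' ⟶ Y')
    [∀ Z, Epi (p ▷ Z)] [∀ Z, Epi (p' ▷ Z)] : Epi (p ⊗ₘ p') := by
  have := epi_whiskerLeft_of_epi_whiskerRight p' Y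
  rw [MonoidalCategory.tensorHom_def]
  infer_instance

theorem mono_tensorHom_of_mono_whiskerRight {X Y X' Y' : C} (i : X ⟶ Y) (i' : X' ⟶ Y')
    [∀ Z, Mono (i ▷ Z)] [∀ Z, Mono (i' ▷ Z)] : Mono (i ⊗ₘ i') := by
  have := mono_whiskerLeft_of_mono_whiskerRight i' Y
  rw [MonoidalCategory.tensorHom_def]
  infer_instance

/-- Braiding brings `p'` to the leftmost position, so right whiskerings of both factors suffice. -/
theorem epi_tensorHom_whiskerRight {X Y X' Y' : C} (p : X ⟶ Y) (p' : X' ⟶ Y')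
    [∀ Z, Epi (p ▷ Z)] [∀ Z, Epi (p' ▷ Z)] (Z : C) : Epi ((p ⊗ₘ p') ▷ Z) := by
  have h : (p ⊗ₘ p') ▷ Z = (α_ X X' Z).hom ≫ (p ⊗ₘ 𝟙 (X' ⊗ Z)) ≫ (α_ Y X' Z).inv ≫
      (β_ Y X').hom ▷ Z ≫ (α_ X' Y Z).hom ≫ (p' ⊗ₘ 𝟙 (Y ⊗ Z)) ≫ (α_ Y' Y Z).inv ≫
      (β_ Y Y').inv ▷ Z := by
    simp [← comp_whiskerRight]
    simp [MonoidalCategory.tensorHom_def]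
  rw [h, tensorHom_id, tensorHom_id]
  infer_instance

theorem mono_tensorHom_whiskerRight {X Y X' Y' : C} (i : X ⟶ Y) (i' : X' ⟶ Y')
    [∀ Z, Mono (i ▷ Z)] [∀ Z, Mono (i' ▷ Z)] (Z : C) : Mono ((i ⊗ₘ i') ▷ Z) := by
  have h : (i ⊗ₘ i') ▷ Z = (α_ X X' Z).hom ≫ (i ⊗ₘ 𝟙 (X' ⊗ Z)) ≫ (α_ Y X' Z).inv ≫
      (β_ Y X').hom ▷ Z ≫ (α_ X' Y Z).hom ≫ (i' ⊗ₘ 𝟙 (Y ⊗ Z)) ≫ (α_ Y' Y Z).inv ≫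
      (β_ Y Y').inv ▷ Z := by
    simp [← comp_whiskerRight]
    simp [MonoidalCategory.tensorHom_def]
  rw [h, tensorHom_id, tensorHom_id]
  infer_instance

/-- Once the operations descend, each axiom holds after precomposition with a tensor power of `p`,
and these powers are epi. The unit needs no descent: it is `η[B] ≫ p`. -/
theorem exists_hopfObj_of_epi {B Q : C} [HopfObj B] [IsCommMonObj B] [IsCommComonObj B]
    (p : B ⟶ Q) [hp : ∀ Z, Epi (p ▷ Z)]
    (hm : ∃ m, (p ⊗ₘ p) ≫ m = μ[B] ≫ p) (hd : ∃ d, p ≫ d = Δ[B] ≫ (p ⊗ₘ p))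
    (he : ∃ e, p ≫ e = ε[B]) (hs : ∃ s, p ≫ s = HopfObj.antipode ≫ p) :
    ∃ _ : HopfObj Q, IsBimonHom p ∧ IsCommMonObj Q ∧ IsCommComonObj Q := by
  obtain ⟨m, hm⟩ := hm
  obtain ⟨d, hd⟩ := hd
  obtain ⟨e, he⟩ := he
  obtain ⟨s, hs⟩ := hs
  have hp1 : Epi p := epi_of_epi_whiskerRight_unit p
  have hpl := epi_whiskerLeft_of_epi_whiskerRight p
  have hp2 : Epi (p ⊗ₘ p) := epi_tensorHom_of_epi_whiskerRight p p
  have hp3 : Epi ((p ⊗ₘ p) ⊗ₘ p) := by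
    have := epi_tensorHom_whiskerRight p p
    exact epi_tensorHom_of_epi_whiskerRight _ _
  have hme : m ≫ e = (e ⊗ₘ e) ≫ (λ_ (𝟙_ C)).hom := by
    rw [← cancel_epi (p ⊗ₘ p), reassoc_of% hm, he, tensorHom_comp_tensorHom_assoc, he,
      Bimon.mul_counit]
  let hQ : HopfObj Q :=
    { one := η[B] ≫ p
      mul := m
      one_mul := by
        rw [← cancel_epi (𝟙_ C ◁ p)]
        simp only [← id_tensorHom, ← tensorHom_id, tensorHom_comp_tensorHom_assoc,
          Category.id_comp, Category.comp_id]
        conv_lhs => rw [← Category.id_comp p, ← Category.assoc, ← tensorHom_comp_tensorHom_assoc, hm]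
        simp
      mul_one := by
        rw [← cancel_epi (p ▷ 𝟙_ C)]
        simp only [← id_tensorHom, ← tensorHom_id, tensorHom_comp_tensorHom_assoc,
          Category.id_comp, Category.comp_id]
        conv_lhs => rw [← Category.id_comp p, ← Category.assoc, ← tensorHom_comp_tensorHom_assoc, hm]
        simp
      mul_assoc := by
        have h1 : ((p ⊗ₘ p) ⊗ₘ p) ≫ m ▷ Q ≫ m = μ[B] ▷ B ≫ μ[B] ≫ p := by
          simp only [← tensorHom_id, tensorHom_comp_tensorHom_assoc, Category.comp_id, hm]
          have h := tensorHom_comp_tensorHom_assoc μ[B] (𝟙 B) p p m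
          rw [Category.id_comp, hm] at h
          exact h.symm
        have h2 : (p ⊗ₘ (p ⊗ₘ p)) ≫ Q ◁ m ≫ m = B ◁ μ[B] ≫ μ[B] ≫ p := by
          simp only [← id_tensorHom, tensorHom_comp_tensorHom_assoc, Category.comp_id, hm]
          have h := tensorHom_comp_tensorHom_assoc (𝟙 B) μ[B] p p m
          rw [Category.id_comp, hm] at h
          exact h.symm
        rw [← cancel_epi ((p ⊗ₘ p) ⊗ₘ p), h1, associator_naturality_assoc, h2]
        simp
      counit := e
      comul := d
      counit_comul := by
        rw [← cancel_epi p, reassoc_of% hd, ← tensorHom_id, tensorHom_comp_tensorHom, he]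
        simp
      comul_counit := by
        rw [← cancel_epi p, reassoc_of% hd, ← id_tensorHom, tensorHom_comp_tensorHom, he]
        simp
      comul_assoc := by
        rw [← cancel_epi p, reassoc_of% hd, reassoc_of% hd, ← id_tensorHom, ← tensorHom_id,
          tensorHom_comp_tensorHom, tensorHom_comp_tensorHom_assoc, hd, Category.comp_id]
        have h := ComonObj.comul_assoc B =≫ (p ⊗ₘ (p ⊗ₘ p))
        simp only [Category.assoc, ← associator_naturality, ← id_tensorHom, ← tensorHom_id,
          tensorHom_comp_tensorHom, tensorHom_comp_tensorHom_assoc, Category.id_comp] at h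
        exact h
      mul_comul := by
        rw [← cancel_epi (p ⊗ₘ p), reassoc_of% hm, hd, BimonObj.mul_comul_assoc,
          tensorHom_comp_tensorHom_assoc, hd, ← tensorHom_comp_tensorHom_assoc,
          tensorμ_natural_assoc, tensorHom_comp_tensorHom, tensorHom_comp_tensorHom, hm]
      one_comul := by
        rw [Category.assoc, hd, BimonObj.one_comul_assoc]
        simp only [MonObj.tensorObj.one_def, Category.assoc, tensorHom_comp_tensorHom]
        rfl
      mul_counit := hme
      one_counit := by simp [he]
      antipode := s
      antipode_left := by
        rw [← cancel_epi p, reassoc_of% hd, reassoc_of% he, ← tensorHom_id,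
          tensorHom_comp_tensorHom_assoc, hs, Category.comp_id]
        have := HopfObj.antipode_left B =≫ p
        simp only [Category.assoc, ← hm, ← tensorHom_id, tensorHom_comp_tensorHom_assoc,
          Category.id_comp] at this
        exact this
      antipode_right := by
        rw [← cancel_epi p, reassoc_of% hd, reassoc_of% he, ← id_tensorHom,
          tensorHom_comp_tensorHom_assoc, hs, Category.comp_id]
        have := HopfObj.antipode_right B =≫ p
        simp only [Category.assoc, ← hm, ← id_tensorHom, tensorHom_comp_tensorHom_assoc,
          Category.id_comp] at this
        exact this }
  refine ⟨hQ, ?_, ⟨?_⟩, ⟨?_⟩⟩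
  · exact { one_hom := rfl, mul_hom := hm.symm, hom_counit := he, hom_comul := hd }
  · change (β_ Q Q).hom ≫ m = m
    rw [← cancel_epi (p ⊗ₘ p), BraidedCategory.braiding_naturality_assoc, hm,
      IsCommMonObj.mul_comm_assoc]
  · change d ≫ (β_ Q Q).hom = d
    rw [← cancel_epi p, reassoc_of% hd, BraidedCategory.braiding_naturality, hd,
      IsCommComonObj.comul_comm_assoc]

theorem exists_hopfObj_of_mono {A K : C} [HopfObj A] [IsCommMonObj A] [IsCommComonObj A]
    (i : K ⟶ A) [hi : ∀ Z, Mono (i ▷ Z)]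
    (hm : ∃ m, m ≫ i = (i ⊗ₘ i) ≫ μ[A]) (hd : ∃ d, d ≫ (i ⊗ₘ i) = i ≫ Δ[A])
    (he : ∃ e, e ≫ i = η[A]) (hs : ∃ s, s ≫ i = i ≫ HopfObj.antipode) :
    ∃ _ : HopfObj K, IsBimonHom i ∧ IsCommMonObj K ∧ IsCommComonObj K := by
  obtain ⟨m, hm⟩ := hm
  obtain ⟨d, hd⟩ := hd
  obtain ⟨e, he⟩ := he
  obtain ⟨s, hs⟩ := hs
  have hi1 : Mono i := mono_of_mono_whiskerRight_unit i
  have hil := mono_whiskerLeft_of_mono_whiskerRight i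
  have hi2 : Mono (i ⊗ₘ i) := mono_tensorHom_of_mono_whiskerRight i i
  have hi3 : Mono (i ⊗ₘ (i ⊗ₘ i)) := by
    have := mono_tensorHom_whiskerRight i i
    exact mono_tensorHom_of_mono_whiskerRight _ _
  have hed : e ≫ d = (λ_ (𝟙_ C)).inv ≫ (e ⊗ₘ e) := by
    rw [← cancel_mono (i ⊗ₘ i), Category.assoc, hd, reassoc_of% he, Category.assoc,
      tensorHom_comp_tensorHom, he, Bimon.one_comul]
  let hK : HopfObj K :=
    { one := e
      mul := m
      one_mul := by
        rw [← cancel_mono i, Category.assoc, hm, ← tensorHom_id, tensorHom_comp_tensorHom_assoc, he]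
        simp
      mul_one := by
        rw [← cancel_mono i, Category.assoc, hm, ← id_tensorHom, tensorHom_comp_tensorHom_assoc, he]
        simp
      mul_assoc := by
        rw [← cancel_mono i]
        simp only [Category.assoc, hm, ← id_tensorHom, ← tensorHom_id,
          tensorHom_comp_tensorHom_assoc, Category.id_comp]
        have h := ((i ⊗ₘ i) ⊗ₘ i) ≫= MonObj.mul_assoc A
        simp only [associator_naturality_assoc, ← id_tensorHom, ← tensorHom_id,
          tensorHom_comp_tensorHom_assoc, Category.comp_id] at h
        exact h
      counit := i ≫ ε[A]
      comul := d
      counit_comul := by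
        rw [← cancel_mono (𝟙_ C ◁ i)]
        have h := hd =≫ ε[A] ▷ A
        simp only [Category.assoc, ← id_tensorHom, ← tensorHom_id, tensorHom_comp_tensorHom,
          Category.id_comp, Category.comp_id] at h ⊢
        rw [h]
        simp
      comul_counit := by
        rw [← cancel_mono (i ▷ 𝟙_ C)]
        have h := hd =≫ A ◁ ε[A]
        simp only [Category.assoc, ← id_tensorHom, ← tensorHom_id, tensorHom_comp_tensorHom,
          Category.id_comp, Category.comp_id] at h ⊢
        rw [h]
        simp
      comul_assoc := by
        have h1 : d ≫ d ▷ K ≫ ((i ⊗ₘ i) ⊗ₘ i) = i ≫ Δ[A] ≫ Δ[A] ▷ A := by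
          have := hd =≫ (Δ[A] ▷ A)
          simp only [← tensorHom_id, tensorHom_comp_tensorHom, Category.comp_id,
            Category.id_comp, Category.assoc] at this ⊢
          rw [hd, this]
        have h2 : d ≫ K ◁ d ≫ (i ⊗ₘ (i ⊗ₘ i)) = i ≫ Δ[A] ≫ A ◁ Δ[A] := by
          have := hd =≫ (A ◁ Δ[A])
          simp only [← id_tensorHom, tensorHom_comp_tensorHom, Category.comp_id,
            Category.id_comp, Category.assoc] at this ⊢
          rw [hd, this]
        rw [← cancel_mono (i ⊗ₘ (i ⊗ₘ i))]
        simp only [Category.assoc, h2, ← associator_naturality, reassoc_of% h1]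
        simp
      mul_comul := by
        rw [← cancel_mono (i ⊗ₘ i)]
        simp only [Category.assoc, hd, reassoc_of% hm, tensorHom_comp_tensorHom, hm,
          BimonObj.mul_comul]
        rw [← tensorHom_comp_tensorHom, ← tensorμ_natural_assoc, tensorHom_comp_tensorHom_assoc,
          tensorHom_comp_tensorHom_assoc, hd]
      one_comul := hed
      mul_counit := by
        rw [reassoc_of% hm]
        simp
      one_counit := by rw [reassoc_of% he]; simp
      antipode := s
      antipode_left := by
        rw [← cancel_mono i]
        have := hd =≫ (HopfObj.antipode ▷ A ≫ μ[A])
        simp only [Category.assoc, ← tensorHom_id, tensorHom_comp_tensorHom_assoc, hm, hs, he,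
          Category.id_comp, Category.comp_id] at this ⊢
        rw [this]
        simp
      antipode_right := by
        rw [← cancel_mono i]
        have := hd =≫ (A ◁ HopfObj.antipode ≫ μ[A])
        simp only [Category.assoc, ← id_tensorHom, tensorHom_comp_tensorHom_assoc, hm, hs, he,
          Category.id_comp, Category.comp_id] at this ⊢
        rw [this]
        simp }
  refine ⟨hK, ?_, ⟨?_⟩, ⟨?_⟩⟩
  · exact { one_hom := he, mul_hom := hm, hom_counit := rfl, hom_comul := hd.symm }
  · change (β_ K K).hom ≫ m = m
    rw [← cancel_mono i, Category.assoc, hm, ← BraidedCategory.braiding_naturality_assoc,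
      IsCommMonObj.mul_comm]
  · change d ≫ (β_ K K).hom = d
    rw [← cancel_mono (i ⊗ₘ i), Category.assoc, ← BraidedCategory.braiding_naturality,
      reassoc_of% hd, hd, IsCommComonObj.comul_comm]

end

/-! ### Universal properties of stable (co)equalizers, in one and two variables. -/

section

variable {C : Type u} [Category.{v} C] [MonoidalCategory C]

theorem IsStableCoeq.comp_iso {W X Q Q' : C} {f g : W ⟶ X} {p : X ⟶ Q} (h : IsStableCoeq f g p)
    (e : Q ⟶ Q') [IsIso e] : IsStableCoeq f g (p ≫ e) where
  condition := by rw [reassoc_of% h.condition]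
  epi_whiskerRight Y := by
    have := h.epi_whiskerRight Y
    rw [comp_whiskerRight]
    infer_instance
  exists_desc k hk := by
    obtain ⟨l, hl⟩ := h.exists_desc k hk
    exact ⟨inv e ▷ _ ≫ l, by simp [← comp_whiskerRight_assoc, hl]⟩

theorem IsStableEq.iso_comp {W X K K' : C} {f g : X ⟶ W} {i : K ⟶ X} (h : IsStableEq f g i)
    (e : K' ⟶ K) [IsIso e] : IsStableEq f g (e ≫ i) where
  condition := by rw [Category.assoc, h.condition, Category.assoc]
  mono_whiskerRight Y := by
    have := h.mono_whiskerRight Y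
    rw [comp_whiskerRight]
    infer_instance
  exists_lift k hk := by
    obtain ⟨l, hl⟩ := h.exists_lift k hk
    exact ⟨l ≫ inv e ▷ _, by simp [← comp_whiskerRight, hl]⟩

theorem IsStableCoeq.epi {W X Q : C} {f g : W ⟶ X} {p : X ⟶ Q} (h : IsStableCoeq f g p) :
    Epi p :=
  have := h.epi_whiskerRight (𝟙_ C)
  epi_of_epi_whiskerRight_unit p

theorem IsStableEq.mono {W X K : C} {f g : X ⟶ W} {i : K ⟶ X} (h : IsStableEq f g i) :
    Mono i :=
  have := h.mono_whiskerRight (𝟙_ C)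
  mono_of_mono_whiskerRight_unit i

theorem IsStableCoeq.exists_desc' {W X Q Z : C} {f g : W ⟶ X} {p : X ⟶ Q}
    (h : IsStableCoeq f g p) (k : X ⟶ Z) (hk : f ≫ k = g ≫ k) : ∃ l, p ≫ l = k := by
  obtain ⟨l, hl⟩ := h.exists_desc ((ρ_ X).hom ≫ k) (by
    rw [rightUnitor_naturality_assoc, hk, rightUnitor_naturality_assoc])
  exact ⟨(ρ_ Q).inv ≫ l, by
    rw [rightUnitor_inv_naturality_assoc, hl, Iso.inv_hom_id_assoc]⟩

theorem IsStableEq.exists_lift' {W X K Z : C} {f g : X ⟶ W} {i : K ⟶ X}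
    (h : IsStableEq f g i) (k : Z ⟶ X) (hk : k ≫ f = k ≫ g) : ∃ l, l ≫ i = k := by
  obtain ⟨l, hl⟩ := h.exists_lift (k ≫ (ρ_ X).inv) (by
    simp only [Category.assoc, ← rightUnitor_inv_naturality, reassoc_of% hk])
  exact ⟨l ≫ (ρ_ K).hom, by
    rw [Category.assoc, ← rightUnitor_naturality, reassoc_of% hl, Iso.inv_hom_id, Category.comp_id]⟩

variable [BraidedCategory C]

/-- Descend one variable at a time, with the braiding moving the second to the left. The second
relation, now over `Q`, is checked after cancelling the epimorphism `W' ◁ p`. -/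
theorem IsStableCoeq.exists_desc₂ {W X Q W' X' Q' Z : C} {f g : W ⟶ X} {p : X ⟶ Q}
    {f' g' : W' ⟶ X'} {p' : X' ⟶ Q'} (h : IsStableCoeq f g p) (h' : IsStableCoeq f' g' p')
    (k : X ⊗ X' ⟶ Z) (hk : f ▷ X' ≫ k = g ▷ X' ≫ k) (hk' : X ◁ f' ≫ k = X ◁ g' ≫ k) :
    ∃ l, (p ⊗ₘ p') ≫ l = k := by
  have := h.epi_whiskerRight
  obtain ⟨l, hl⟩ := h.exists_desc k hk
  obtain ⟨l', hl'⟩ := h'.exists_desc ((β_ X' Q).hom ≫ l) (by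
    have := epi_whiskerLeft_of_epi_whiskerRight p W'
    rw [← cancel_epi (W' ◁ p), whisker_exchange_assoc, whisker_exchange_assoc,
      BraidedCategory.braiding_naturality_right_assoc, hl,
      BraidedCategory.braiding_naturality_left_assoc, hk',
      BraidedCategory.braiding_naturality_left_assoc])
  refine ⟨(β_ Q' Q).inv ≫ l', ?_⟩
  rw [MonoidalCategory.tensorHom_def, Category.assoc,
    BraidedCategory.braiding_inv_naturality_right_assoc, hl']
  simp [hl]

theorem IsStableEq.exists_lift₂ {W X K W' X' K' Z : C} {f g : X ⟶ W} {i : K ⟶ X}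
    {f' g' : X' ⟶ W'} {i' : K' ⟶ X'} (h : IsStableEq f g i) (h' : IsStableEq f' g' i')
    (k : Z ⟶ X ⊗ X') (hk : k ≫ f ▷ X' = k ≫ g ▷ X') (hk' : k ≫ X ◁ f' = k ≫ X ◁ g') :
    ∃ l, l ≫ (i ⊗ₘ i') = k := by
  have := h.mono_whiskerRight
  obtain ⟨l, hl⟩ := h.exists_lift k hk
  obtain ⟨l', hl'⟩ := h'.exists_lift (l ≫ (β_ X' K).inv) (by
    have := mono_whiskerLeft_of_mono_whiskerRight i W'
    rw [← cancel_mono (W' ◁ i)]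
    simp only [Category.assoc, ← whisker_exchange,
      ← BraidedCategory.braiding_inv_naturality_left_assoc, reassoc_of% hl]
    simp only [← BraidedCategory.braiding_inv_naturality_right, reassoc_of% hk'])
  refine ⟨l' ≫ (β_ K' K).hom, ?_⟩
  rw [MonoidalCategory.tensorHom_def', Category.assoc,
    ← BraidedCategory.braiding_naturality_left_assoc, reassoc_of% hl']
  simp [hl]

/-- A morphism out of the target of a bimonoid epimorphism `p` is a bimonoid homomorphism as soon as
its composite with `p` is. -/
theorem isBimonHom_of_epi_comp {B Q D : C} [BimonObj B] [BimonObj Q] [BimonObj D] (p : B ⟶ Q)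
    [IsBimonHom p] [Epi p] [Epi (p ⊗ₘ p)] (l : Q ⟶ D) [IsBimonHom (p ≫ l)] : IsBimonHom l where
  one_hom := by rw [← IsMonHom.one_hom p, Category.assoc, IsMonHom.one_hom]
  mul_hom := by
    rw [← cancel_epi (p ⊗ₘ p), ← IsMonHom.mul_hom_assoc, IsMonHom.mul_hom,
      tensorHom_comp_tensorHom_assoc]
  hom_counit := by
    rw [← cancel_epi p, IsComonHom.hom_counit p, ← Category.assoc, IsComonHom.hom_counit]
  hom_comul := by
    rw [← cancel_epi p, IsComonHom.hom_comul_assoc, ← Category.assoc, IsComonHom.hom_comul,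
      tensorHom_comp_tensorHom]

theorem isBimonHom_of_comp_mono {K A D : C} [BimonObj K] [BimonObj A] [BimonObj D] (i : K ⟶ A)
    [IsBimonHom i] [Mono i] [Mono (i ⊗ₘ i)] (l : D ⟶ K) [IsBimonHom (l ≫ i)] : IsBimonHom l where
  one_hom := by
    rw [← cancel_mono i, Category.assoc, IsMonHom.one_hom, IsMonHom.one_hom]
  mul_hom := by
    rw [← cancel_mono i, Category.assoc, IsMonHom.mul_hom, Category.assoc, IsMonHom.mul_hom,
      tensorHom_comp_tensorHom_assoc]
  hom_counit := by rw [← IsComonHom.hom_counit i, ← Category.assoc, IsComonHom.hom_counit]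
  hom_comul := by
    rw [← cancel_mono (i ⊗ₘ i), Category.assoc, ← IsComonHom.hom_comul, ← Category.assoc,
      IsComonHom.hom_comul, Category.assoc, tensorHom_comp_tensorHom]

/-- Evaluate the action at the unit of `B`. With the converse `act_comp_eq_of_comp_eq` for
homomorphisms, coequalizing the translation and trivial actions amounts to killing `f`. -/
theorem comp_eq_of_act_comp_eq {A B Q : C} [BimonObj A] [BimonObj B] (f : A ⟶ B) (p : B ⟶ Q)
    (h : (f ▷ B ≫ μ[B]) ≫ p = trivLeftAct A B ≫ p) : f ≫ p = ε[A] ≫ η[B] ≫ p := by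
  have h' := ((ρ_ A).inv ≫ A ◁ η[B]) ≫= h
  have h1 : (ρ_ A).inv ≫ A ◁ η[B] ≫ f ▷ B ≫ μ[B] = f := by
    rw [whisker_exchange_assoc]; simp
  have h2 : (ρ_ A).inv ≫ A ◁ η[B] ≫ trivLeftAct A B = ε[A] ≫ η[B] := by
    simp only [trivLeftAct]
    rw [whisker_exchange_assoc]; simp [unitors_equal]
  simp only [Category.assoc, reassoc_of% h1, reassoc_of% h2] at h'
  simpa using h'

theorem comp_eq_of_comp_coact_eq {A B K : C} [BimonObj A] [BimonObj B] (f : A ⟶ B) (i : K ⟶ A)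
    (h : i ≫ Δ[A] ≫ f ▷ A = i ≫ trivLeftCoact B A) : i ≫ f = i ≫ ε[A] ≫ η[B] := by
  have h' := h =≫ (B ◁ ε[A] ≫ (ρ_ B).hom)
  have h1 : Δ[A] ≫ f ▷ A ≫ B ◁ ε[A] ≫ (ρ_ B).hom = f := by
    rw [← whisker_exchange_assoc]; simp
  have h2 : trivLeftCoact B A ≫ B ◁ ε[A] ≫ (ρ_ B).hom = ε[A] ≫ η[B] := by
    simp only [trivLeftCoact, Category.assoc]
    rw [← whisker_exchange_assoc]; simp [unitors_inv_equal]
  simpa only [Category.assoc, h1, h2] using h'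

theorem act_comp_eq_of_comp_eq {A B D : C} [BimonObj A] [BimonObj B] [BimonObj D] (f : A ⟶ B)
    (g : B ⟶ D) [IsBimonHom g] (h : f ≫ g = ε[A] ≫ η[D]) :
    (f ▷ B ≫ μ[B]) ≫ g = trivLeftAct A B ≫ g := by
  rw [Category.assoc, IsMonHom.mul_hom, ← tensorHom_id, tensorHom_comp_tensorHom_assoc, h,
    trivLeftAct, Category.assoc, Category.id_comp]
  conv_lhs => rw [← Category.id_comp g, ← tensorHom_comp_tensorHom_assoc]
  simp

theorem comp_coact_eq_of_comp_eq {A B D : C} [BimonObj A] [BimonObj B] [BimonObj D] (f : A ⟶ B)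
    (g : D ⟶ A) [IsBimonHom g] (h : g ≫ f = ε[D] ≫ η[B]) :
    g ≫ Δ[A] ≫ f ▷ A = g ≫ trivLeftCoact B A := by
  rw [IsComonHom.hom_comul_assoc, ← tensorHom_id, tensorHom_comp_tensorHom, h,
    trivLeftCoact, Category.comp_id]
  conv_lhs => rw [← Category.comp_id g, ← tensorHom_comp_tensorHom]
  simp
end

/-! ### Kernels and cokernels of bicommutative Hopf monoids, computed in the base category. -/

section

variable {C : Type u} [Category.{v} C] [MonoidalCategory C] [SymmetricCategory C]

theorem exists_hopfObj_of_isStableCoeq {A B Q : C} [HopfObj A] [IsCommMonObj A] [IsCommComonObj A]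
    [HopfObj B] [IsCommMonObj B] [IsCommComonObj B] (f : A ⟶ B) [IsBimonHom f] {p : B ⟶ Q}
    (hp : IsStableCoeq (f ▷ B ≫ μ[B]) (trivLeftAct A B) p) :
    ∃ _ : HopfObj Q, IsBimonHom p ∧ IsCommMonObj Q ∧ IsCommComonObj Q := by
  have := hp.epi_whiskerRight
  have hl : (f ▷ B ≫ μ[B]) ▷ B ≫ μ[B] ≫ p = trivLeftAct A B ▷ B ≫ μ[B] ≫ p := by
    have h : (f ▷ B ≫ μ[B]) ▷ B ≫ μ[B] =
        (α_ A B B).hom ≫ A ◁ μ[B] ≫ f ▷ B ≫ μ[B] := by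
      rw [whisker_exchange_assoc]; simp
    have h' : trivLeftAct A B ▷ B ≫ μ[B] = (α_ A B B).hom ≫ A ◁ μ[B] ≫ trivLeftAct A B := by
      simp only [trivLeftAct]
      rw [whisker_exchange_assoc]; simp
    have hc := hp.condition
    simp only [Category.assoc] at hc
    rw [reassoc_of% h, hc, reassoc_of% h']
  refine exists_hopfObj_of_epi p (hp.exists_desc₂ hp _ hl ?_) (hp.exists_desc' _ ?_)
    (hp.exists_desc' _ ?_) (hp.exists_desc' _ ?_)
  -- Commutativity reduces invariance in the second variable to `hl`, which is associativity.
  · have h : μ[B] ≫ p = (β_ B B).hom ≫ μ[B] ≫ p := by simp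
    rw [h, BraidedCategory.braiding_naturality_right_assoc, hl,
      BraidedCategory.braiding_naturality_right_assoc]
  -- The comultiplication of `B` is equivariant along `Δ[A]`, both for the translation action and
  -- for the trivial one.
  · have h : (f ▷ B ≫ μ[B]) ≫ Δ[B] = (Δ[A] ⊗ₘ Δ[B]) ≫
        tensorLeftAct (f ▷ B ≫ μ[B]) (f ▷ B ≫ μ[B]) := by
      rw [Category.assoc, BimonObj.mul_comul, ← tensorHom_id, tensorHom_comp_tensorHom_assoc,
        IsComonHom.hom_comul, Category.id_comp, tensorLeftAct, ← tensorHom_comp_tensorHom,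
        ← tensorμ_natural_assoc, tensorHom_comp_tensorHom_assoc, id_tensorHom_id, Category.comp_id]
    have h' : trivLeftAct A B ≫ Δ[B] = (Δ[A] ⊗ₘ Δ[B]) ≫
        tensorLeftAct (trivLeftAct A B) (trivLeftAct A B) := by
      rw [tensorLeftAct_triv, trivLeftAct, trivLeftAct, ← tensorHom_id, ← tensorHom_id,
        tensorHom_comp_tensorHom_assoc, Comon.tensorObj_counit]
      simp [MonoidalCategory.tensorHom_def]
    rw [reassoc_of% h', ← Category.assoc, h, Category.assoc, tensorLeftAct, tensorLeftAct,
      Category.assoc, Category.assoc, tensorHom_comp_tensorHom, tensorHom_comp_tensorHom,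
      hp.condition]
  · rw [Category.assoc, Bimon.mul_counit, ← tensorHom_id, tensorHom_comp_tensorHom_assoc,
      IsComonHom.hom_counit, trivLeftAct]
    simp [MonoidalCategory.tensorHom_def]
  -- The antipode reverses products; commutativity turns this into equivariance along the antipode
  -- of `A`.
  · have h : (f ▷ B ≫ μ[B]) ≫ HopfObj.antipode =
        (HopfObj.antipode ⊗ₘ HopfObj.antipode) ≫ f ▷ B ≫ μ[B] := by
      rw [Category.assoc, HopfObj.mul_antipode, ← tensorHom_id, tensorHom_comp_tensorHom_assoc,
        Category.id_comp, HopfObj.hom_antipode, IsCommMonObj.mul_comm, tensorHom_comp_tensorHom_assoc,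
        Category.comp_id]
    have h' : trivLeftAct A B ≫ HopfObj.antipode =
        (HopfObj.antipode ⊗ₘ HopfObj.antipode) ≫ trivLeftAct A B := by
      rw [trivLeftAct, ← tensorHom_id, tensorHom_comp_tensorHom_assoc, HopfObj.antipode_counit]
      simp [MonoidalCategory.tensorHom_def]
    rw [reassoc_of% h', ← Category.assoc, h, Category.assoc, hp.condition]

theorem exists_hopfObj_of_isStableEq {A B K : C} [HopfObj A] [IsCommMonObj A] [IsCommComonObj A]
    [HopfObj B] [IsCommMonObj B] [IsCommComonObj B] (f : A ⟶ B) [IsBimonHom f] {i : K ⟶ A}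
    (hi : IsStableEq (Δ[A] ≫ f ▷ A) (trivLeftCoact B A) i) :
    ∃ _ : HopfObj K, IsBimonHom i ∧ IsCommMonObj K ∧ IsCommComonObj K := by
  have := hi.mono_whiskerRight
  have hc {Z : C} (k : B ⊗ A ⟶ Z) :
      i ≫ (Δ[A] ≫ f ▷ A) ≫ k = i ≫ trivLeftCoact B A ≫ k := by
    rw [← Category.assoc, hi.condition, Category.assoc]
  have hl : (i ≫ Δ[A]) ≫ (Δ[A] ≫ f ▷ A) ▷ A = (i ≫ Δ[A]) ≫ trivLeftCoact B A ▷ A := by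
    have h : Δ[A] ≫ (Δ[A] ≫ f ▷ A) ▷ A = (Δ[A] ≫ f ▷ A) ≫ B ◁ Δ[A] ≫ (α_ B A A).inv := by
      rw [Category.assoc, ← whisker_exchange_assoc]; simp
    have h' : Δ[A] ≫ trivLeftCoact B A ▷ A =
        trivLeftCoact B A ≫ B ◁ Δ[A] ≫ (α_ B A A).inv := by
      simp only [trivLeftCoact, Category.assoc]
      rw [← whisker_exchange_assoc]; simp
    rw [Category.assoc, h, hc, Category.assoc, h']
  refine exists_hopfObj_of_mono i (hi.exists_lift' _ ?_) (hi.exists_lift₂ hi _ hl ?_)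
    (hi.exists_lift' _ ?_) (hi.exists_lift' _ ?_)
  · have h : μ[A] ≫ Δ[A] ≫ f ▷ A =
        tensorLeftCoact (Δ[A] ≫ f ▷ A) (Δ[A] ≫ f ▷ A) ≫ (μ[B] ⊗ₘ μ[A]) := by
      rw [BimonObj.mul_comul_assoc, ← tensorHom_id, tensorHom_comp_tensorHom,
        IsMonHom.mul_hom, Category.comp_id, tensorLeftCoact, ← tensorHom_comp_tensorHom,
        Category.assoc, Category.assoc, tensorμ_natural_assoc, tensorHom_comp_tensorHom,
        id_tensorHom_id, Category.id_comp]
    have h' : μ[A] ≫ trivLeftCoact B A =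
        tensorLeftCoact (trivLeftCoact B A) (trivLeftCoact B A) ≫ (μ[B] ⊗ₘ μ[A]) := by
      rw [tensorLeftCoact_triv, trivLeftCoact, trivLeftCoact, ← tensorHom_id, ← tensorHom_id,
        Category.assoc, tensorHom_comp_tensorHom, MonObj.tensorObj.one_def]
      simp [MonoidalCategory.tensorHom_def']
    simp only [Category.assoc] at h ⊢
    rw [h', h, tensorLeftCoact, tensorLeftCoact, Category.assoc, Category.assoc,
      tensorHom_comp_tensorHom_assoc, tensorHom_comp_tensorHom_assoc, hi.condition]
  · have h : i ≫ Δ[A] = (i ≫ Δ[A]) ≫ (β_ A A).hom := by simp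
    rw [h, Category.assoc _ (β_ A A).hom, ← BraidedCategory.braiding_naturality_left,
      ← Category.assoc, hl, Category.assoc, BraidedCategory.braiding_naturality_left,
      Category.assoc _ (β_ A A).hom]
  · rw [Bimon.one_comul_assoc, ← tensorHom_id, tensorHom_comp_tensorHom,
      IsMonHom.one_hom, trivLeftCoact]
    simp [MonoidalCategory.tensorHom_def']
  · have h : HopfObj.antipode ≫ Δ[A] ≫ f ▷ A =
        (Δ[A] ≫ f ▷ A) ≫ (HopfObj.antipode ⊗ₘ HopfObj.antipode) := by
      rw [reassoc_of% HopfObj.antipode_comul A, IsCommComonObj.comul_comm_assoc, Category.assoc,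
        ← tensorHom_id, tensorHom_comp_tensorHom, tensorHom_comp_tensorHom, HopfObj.hom_antipode,
        Category.comp_id, Category.id_comp]
    have h' : HopfObj.antipode ≫ trivLeftCoact B A =
        trivLeftCoact B A ≫ (HopfObj.antipode ⊗ₘ HopfObj.antipode) := by
      rw [trivLeftCoact, ← tensorHom_id, Category.assoc, tensorHom_comp_tensorHom,
        HopfObj.one_antipode]
      simp [MonoidalCategory.tensorHom_def']
    rw [Category.assoc, Category.assoc, h', h, hc]

/-- The stabilized object of the translation action is itself a bicommutative Hopf monoid, and its
projection kills `f`. Comparing universal properties makes it isomorphic to the abstract cokernel,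
and stability passes along the isomorphism. -/
theorem BicommHopf.isStableCoeq_cokernel [HasCoequalizers C] (hC : IsStable C)
    [HasZeroMorphisms (BicommHopf C)] {A B : BicommHopf C} (f : A ⟶ B) [HasCokernel f] :
    IsStableCoeq (toHom f ▷ B.X ≫ μ[B.X]) (trivLeftAct A.X B.X) (toHom (cokernel.π f)) := by
  have hp := hC.isStableCoeq (isLeftAction_hom (toHom f))
  set p := coequalizer.π (toHom f ▷ B.X ≫ μ[B.X]) (trivLeftAct A.X B.X)
  obtain ⟨_, _, _, _⟩ := exists_hopfObj_of_isStableCoeq _ hp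
  have := hp.epi_whiskerRight
  have := hp.epi
  have := epi_tensorHom_of_epi_whiskerRight p p
  let Q : BicommHopf C := ⟨⟨leftStab (toHom f ▷ B.X ≫ μ[B.X])⟩, ‹_›, ‹_›⟩
  let π : B ⟶ Q := ofHom p
  obtain ⟨l, hl⟩ := hp.exists_desc' (toHom (cokernel.π f)) (act_comp_eq_of_comp_eq _ _ (by
    rw [← toHom_comp, cokernel.condition, toHom_zero]))
  have : IsBimonHom (p ≫ l) := by rw [hl]; infer_instance
  have := isBimonHom_of_epi_comp p l
  let l' : Q ⟶ cokernel f := ofHom l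
  have hl' : π ≫ l' = cokernel.π f := hom_ext hl
  have hπ : f ≫ π = 0 := by
    apply hom_ext
    rw [toHom_zero, toHom_comp, ← IsMonHom.one_hom (toHom π)]
    exact comp_eq_of_act_comp_eq _ _ hp.condition
  have : IsIso l := by
    refine ⟨toHom (cokernel.desc f π hπ), ?_, ?_⟩
    · rw [← cancel_epi p, reassoc_of% hl, ← toHom_comp, cokernel.π_desc]
      simp [π]
    · change toHom (cokernel.desc f π hπ ≫ l') = toHom (𝟙 _)
      congr 1
      rw [← cancel_epi (cokernel.π f), cokernel.π_desc_assoc, hl', Category.comp_id]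
  rw [← hl]
  exact hp.comp_iso l

theorem BicommHopf.isStableEq_kernel [HasEqualizers C] (hC : IsCostable C)
    [HasZeroMorphisms (BicommHopf C)] {A B : BicommHopf C} (f : A ⟶ B) [HasKernel f] :
    IsStableEq (Δ[A.X] ≫ toHom f ▷ A.X) (trivLeftCoact B.X A.X) (toHom (kernel.ι f)) := by
  have hi := hC.isStableEq (isLeftCoaction_hom (toHom f))
  set i := equalizer.ι (Δ[A.X] ≫ toHom f ▷ A.X) (trivLeftCoact B.X A.X)
  obtain ⟨_, _, _, _⟩ := exists_hopfObj_of_isStableEq _ hi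
  have := hi.mono_whiskerRight
  have := hi.mono
  have := mono_tensorHom_of_mono_whiskerRight i i
  let K : BicommHopf C := ⟨⟨leftCostab (Δ[A.X] ≫ toHom f ▷ A.X)⟩, ‹_›, ‹_›⟩
  let j : K ⟶ A := ofHom i
  obtain ⟨l, hl⟩ := hi.exists_lift' (toHom (kernel.ι f)) (comp_coact_eq_of_comp_eq _ _ (by
    rw [← toHom_comp, kernel.condition, toHom_zero]))
  have : IsBimonHom (l ≫ i) := by rw [hl]; infer_instance
  have := isBimonHom_of_comp_mono i l
  let l' : kernel f ⟶ K := ofHom l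
  have hl' : l' ≫ j = kernel.ι f := hom_ext hl
  have hj : j ≫ f = 0 := by
    apply hom_ext
    rw [toHom_zero, toHom_comp, ← IsComonHom.hom_counit (toHom j), Category.assoc]
    exact comp_eq_of_comp_coact_eq _ _ hi.condition
  have : IsIso l := by
    refine ⟨toHom (kernel.lift f j hj), ?_, ?_⟩
    · change toHom (l' ≫ kernel.lift f j hj) = toHom (𝟙 _)
      congr 1
      rw [← cancel_mono (kernel.ι f), Category.assoc, kernel.lift_ι, hl', Category.id_comp]
    · rw [← cancel_mono i, Category.assoc, hl, ← toHom_comp, kernel.lift_ι]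
      simp [j]
  rw [← hl]
  exact hi.iso_comp l

end

/-! ### Multiplication by an element, contraction with a functional, and the integrals they induce.
-/

section

variable {C : Type u} [Category.{v} C] [MonoidalCategory C]

/-- Multiplication from the left by an element `s` of a monoid. -/
def mulLeftBy {A : C} [MonObj A] (s : 𝟙_ C ⟶ A) : A ⟶ A := (λ_ A).inv ≫ s ▷ A ≫ μ[A]

/-- Contraction of the left leg of the comultiplication with a functional `c`. -/
def contractLeftBy {B : C} [ComonObj B] (c : B ⟶ 𝟙_ C) : B ⟶ B := Δ[B] ≫ c ▷ B ≫ (λ_ B).hom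

theorem mul_mulLeftBy {A : C} [MonObj A] (s : 𝟙_ C ⟶ A) :
    μ[A] ≫ mulLeftBy s = mulLeftBy s ▷ A ≫ μ[A] := by
  simp only [mulLeftBy, comp_whiskerRight, Category.assoc, MonObj.mul_assoc]
  rw [leftUnitor_inv_naturality_assoc, whisker_exchange_assoc]
  simp

theorem contractLeftBy_comul {B : C} [ComonObj B] (c : B ⟶ 𝟙_ C) :
    contractLeftBy c ≫ Δ[B] = Δ[B] ≫ contractLeftBy c ▷ B := by
  simp only [contractLeftBy, comp_whiskerRight, Category.assoc, ComonObj.comul_assoc_flip_assoc]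
  rw [← leftUnitor_naturality, ← whisker_exchange_assoc]
  simp

variable [BraidedCategory C]

/-- The braiding exchanges the two sides, so in the bicommutative case only right integrals have to
be constructed. -/
theorem IsRightIntegralAlong.isLeftIntegralAlong {A B : C} [BimonObj A] [BimonObj B]
    [IsCommMonObj A] [IsCommMonObj B] [IsCommComonObj A] [IsCommComonObj B] {f : A ⟶ B}
    [IsBimonHom f] {m : B ⟶ A} (h : IsRightIntegralAlong f m) : IsLeftIntegralAlong f m where
  mul := by
    rw [← IsCommMonObj.mul_comm A, BraidedCategory.braiding_naturality_right_assoc, h.mul,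
      ← BraidedCategory.braiding_naturality_left_assoc, IsCommMonObj.mul_comm_assoc]
  comul := by
    rw [← IsCommComonObj.comul_comm B, Category.assoc,
      ← BraidedCategory.braiding_naturality_left, reassoc_of% h.comul,
      BraidedCategory.braiding_naturality_right, IsCommComonObj.comul_comm_assoc]

theorem IsRightIntegralAlong.comp {A I B : C} [BimonObj A] [BimonObj I] [BimonObj B]
    {f : A ⟶ I} [IsBimonHom f] {g : I ⟶ B} [IsBimonHom g] [IsBimonHom (f ≫ g)]
    {m : I ⟶ A} {n : B ⟶ I} (hm : IsRightIntegralAlong f m) (hn : IsRightIntegralAlong g n) :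
    IsRightIntegralAlong (f ≫ g) (n ≫ m) where
  mul := by
    rw [comp_whiskerRight, Category.assoc, hm.mul, ← whisker_exchange_assoc, reassoc_of% hn.mul,
      MonoidalCategory.whiskerLeft_comp, Category.assoc]
  comul := by
    rw [comp_whiskerRight, reassoc_of% hn.comul, whisker_exchange, reassoc_of% hm.comul,
      MonoidalCategory.whiskerLeft_comp, Category.assoc]

/-- In Sweedler notation `hs` reads `s₁ ⊗ p(s₂) = s ⊗ 1`, hence `s₁a₁ ⊗ p(s₂a₂) = sa₁ ⊗ p(a₂)`. -/
theorem mulLeftBy_comul {A I : C} [BimonObj A] [BimonObj I] (p : A ⟶ I) [IsBimonHom p]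
    (s : 𝟙_ C ⟶ A) (hs : s ≫ Δ[A] ≫ A ◁ p = (λ_ _).inv ≫ (s ⊗ₘ η[I])) :
    mulLeftBy s ≫ Δ[A] ≫ A ◁ p = Δ[A] ≫ (mulLeftBy s ⊗ₘ p) := by
  have key : ((λ_ (𝟙_ C)).inv ⊗ₘ 𝟙 (A ⊗ I)) ≫ tensorμ (𝟙_ C) (𝟙_ C) A I =
      (λ_ (A ⊗ I)).hom ≫ ((λ_ A).inv ⊗ₘ (λ_ I).inv) := by
    rw [tensorHom_id, ← cancel_mono ((λ_ A).hom ⊗ₘ (λ_ I).hom), Category.assoc, Category.assoc,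
      tensorHom_comp_tensorHom]
    simpa using (tensor_left_unitality A I).symm
  have h1 : (s ≫ Δ[A] ≫ A ◁ p ⊗ₘ Δ[A] ≫ A ◁ p) =
      s ▷ A ≫ (Δ[A] ⊗ₘ Δ[A]) ≫ ((𝟙 A ⊗ₘ p) ⊗ₘ (𝟙 A ⊗ₘ p)) := by
    simp only [← id_tensorHom, ← tensorHom_id, tensorHom_comp_tensorHom, Category.id_comp]
  have h2 : s ▷ A ≫ μ[A] ≫ Δ[A] ≫ A ◁ p =
      (s ≫ Δ[A] ≫ A ◁ p ⊗ₘ Δ[A] ≫ A ◁ p) ≫ tensorμ A I A I ≫ (μ[A] ⊗ₘ μ[I]) := by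
    rw [h1, Category.assoc, Category.assoc, tensorμ_natural_assoc, tensorHom_comp_tensorHom,
      id_tensorHom_id, Category.id_comp, ← IsMonHom.mul_hom, BimonObj.mul_comul_assoc,
      ← id_tensorHom, tensorHom_comp_tensorHom, Category.comp_id]
  have h3 : ((λ_ (𝟙_ C)).inv ≫ (s ⊗ₘ η[I]) ⊗ₘ Δ[A] ≫ A ◁ p) =
      𝟙_ C ◁ (Δ[A] ≫ A ◁ p) ≫ ((λ_ (𝟙_ C)).inv ⊗ₘ 𝟙 (A ⊗ I)) ≫
        ((s ⊗ₘ η[I]) ⊗ₘ (𝟙 A ⊗ₘ 𝟙 I)) := by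
    simp only [← id_tensorHom (𝟙_ C), id_tensorHom_id, tensorHom_comp_tensorHom, Category.id_comp,
      Category.comp_id]
  have h4 : (λ_ I).inv ≫ (η[I] ⊗ₘ 𝟙 I) ≫ μ[I] = 𝟙 I := by simp
  rw [mulLeftBy, Category.assoc, Category.assoc, h2, hs, h3, Category.assoc, Category.assoc,
    tensorμ_natural_assoc, reassoc_of% key, leftUnitor_naturality_assoc, Iso.inv_hom_id_assoc,
    tensorHom_comp_tensorHom, tensorHom_comp_tensorHom, h4, Category.assoc, ← id_tensorHom,
    tensorHom_comp_tensorHom, tensorHom_id, Category.id_comp, Category.comp_id]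

/-- Dually, `hc` reads `c(b i(x)) = c(b) ε(x)`, hence `c(b₁ i(x₁)) b₂ i(x₂) = c(b₁) b₂ i(x)`. -/
theorem mul_contractLeftBy {I B : C} [BimonObj I] [BimonObj B] (i : I ⟶ B) [IsBimonHom i]
    (c : B ⟶ 𝟙_ C) (hc : B ◁ i ≫ μ[B] ≫ c = (c ⊗ₘ ε[I]) ≫ (λ_ _).hom) :
    B ◁ i ≫ μ[B] ≫ contractLeftBy c = (contractLeftBy c ⊗ₘ i) ≫ μ[B] := by
  have h1 : (B ◁ i ≫ μ[B] ≫ c ⊗ₘ B ◁ i ≫ μ[B]) =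
      ((𝟙 B ⊗ₘ i) ⊗ₘ (𝟙 B ⊗ₘ i)) ≫ (μ[B] ⊗ₘ μ[B]) ≫ c ▷ B := by
    simp only [← id_tensorHom, ← tensorHom_id, tensorHom_comp_tensorHom, Category.comp_id]
  have h2 : B ◁ i ≫ μ[B] ≫ Δ[B] ≫ c ▷ B =
      (Δ[B] ⊗ₘ Δ[I]) ≫ tensorμ B B I I ≫ (B ◁ i ≫ μ[B] ≫ c ⊗ₘ B ◁ i ≫ μ[B]) := by
    rw [h1, ← tensorμ_natural_assoc, tensorHom_comp_tensorHom_assoc,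
      id_tensorHom_id, Category.comp_id, ← IsComonHom.hom_comul, BimonObj.mul_comul_assoc,
      ← id_tensorHom, tensorHom_comp_tensorHom_assoc, Category.id_comp]
  have h3 : ((c ⊗ₘ ε[I]) ≫ (λ_ (𝟙_ C)).hom ⊗ₘ B ◁ i ≫ μ[B]) =
      ((c ⊗ₘ ε[I]) ⊗ₘ (𝟙 B ⊗ₘ 𝟙 I)) ≫ (λ_ (𝟙_ C)).hom ▷ (B ⊗ I) ≫ 𝟙_ C ◁ (B ◁ i ≫ μ[B]) := by
    simp only [← id_tensorHom (𝟙_ C), ← tensorHom_id, id_tensorHom_id, tensorHom_comp_tensorHom,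
      Category.id_comp, Category.comp_id]
  have h4 : (Δ[I] ≫ (ε[I] ⊗ₘ 𝟙 I)) ≫ (λ_ I).hom = 𝟙 I := by simp
  rw [contractLeftBy, reassoc_of% h2, hc, h3, Category.assoc, Category.assoc,
    ← tensorμ_natural_assoc, leftUnitor_naturality, ← reassoc_of% leftUnitor_monoidal B I,
    tensorHom_comp_tensorHom_assoc, tensorHom_comp_tensorHom_assoc, h4, ← id_tensorHom,
    tensorHom_comp_tensorHom_assoc, Category.id_comp, Category.comp_id, tensorHom_id,
    Category.assoc]

/-- After cancelling `p`, the first axiom is right linearity of multiplication by `s` and the second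
is `mulLeftBy_comul`. -/
theorem isRightIntegralAlong_of_comp_eq_mulLeftBy {A I : C} [BimonObj A] [BimonObj I] {p : A ⟶ I}
    [IsBimonHom p] [∀ Z, Epi (p ▷ Z)] {s : 𝟙_ C ⟶ A}
    (hs : s ≫ Δ[A] ≫ A ◁ p = (λ_ _).inv ≫ (s ⊗ₘ η[I])) {m : I ⟶ A} (hm : p ≫ m = mulLeftBy s) :
    IsRightIntegralAlong p m where
  mul := by
    rw [← cancel_epi (p ▷ A), ← comp_whiskerRight_assoc, hm, ← mul_mulLeftBy,
      ← MonoidalCategory.tensorHom_def_assoc, ← IsMonHom.mul_hom_assoc, hm]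
  comul := by
    have := epi_of_epi_whiskerRight_unit p
    rw [← cancel_epi p, IsComonHom.hom_comul_assoc, ← tensorHom_id, tensorHom_comp_tensorHom,
      reassoc_of% hm, hm, mulLeftBy_comul p s hs, Category.comp_id]

theorem isRightIntegralAlong_of_comp_eq_contractLeftBy {I B : C} [BimonObj I] [BimonObj B]
    {i : I ⟶ B} [IsBimonHom i] [∀ Z, Mono (i ▷ Z)] {c : B ⟶ 𝟙_ C}
    (hc : B ◁ i ≫ μ[B] ≫ c = (c ⊗ₘ ε[I]) ≫ (λ_ _).hom) {n : B ⟶ I}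
    (hn : n ≫ i = contractLeftBy c) :
    IsRightIntegralAlong i n where
  mul := by
    have := mono_of_mono_whiskerRight_unit i
    rw [← cancel_mono i, Category.assoc, IsMonHom.mul_hom, ← tensorHom_id,
      tensorHom_comp_tensorHom_assoc, Category.assoc, Category.assoc, hn,
      mul_contractLeftBy i c hc, Category.id_comp]
  comul := by
    rw [← cancel_mono (i ▷ B), Category.assoc, ← comp_whiskerRight, hn, ← contractLeftBy_comul,
      Category.assoc, Category.assoc, ← MonoidalCategory.tensorHom_def', ← IsComonHom.hom_comul,
      reassoc_of% hn]

/-- `s · m(b) = m(f(s) b) = m(b)`. This and its dual below give the generator property. -/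
theorem IsLeftIntegralAlong.comp_mulLeftBy {A B : C} [BimonObj A] [BimonObj B] {f : A ⟶ B}
    [IsBimonHom f] {m : B ⟶ A} (h : IsLeftIntegralAlong f m) {s : 𝟙_ C ⟶ A} (hs : s ≫ f = η[B]) :
    m ≫ mulLeftBy s = m := by
  rw [mulLeftBy, leftUnitor_inv_naturality_assoc, whisker_exchange_assoc, h.mul,
    ← comp_whiskerRight_assoc, hs]
  simp

theorem IsLeftIntegralAlong.contractLeftBy_comp {A B : C} [BimonObj A] [BimonObj B] {f : A ⟶ B}
    [IsBimonHom f] {m : B ⟶ A} (h : IsLeftIntegralAlong f m) {c : B ⟶ 𝟙_ C} (hc : f ≫ c = ε[A]) :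
    contractLeftBy c ≫ m = m := by
  rw [contractLeftBy, Category.assoc, Category.assoc, ← leftUnitor_naturality,
    ← whisker_exchange_assoc, reassoc_of% h.comul, ← comp_whiskerRight_assoc, hc]
  simp

theorem mulLeftBy_comp {A I : C} [BimonObj A] [BimonObj I] {p : A ⟶ I} [IsBimonHom p]
    {s : 𝟙_ C ⟶ A} (hs : s ≫ p = η[I]) : mulLeftBy s ≫ p = p := by
  rw [mulLeftBy, Category.assoc, Category.assoc, IsMonHom.mul_hom, ← tensorHom_id,
    tensorHom_comp_tensorHom_assoc, hs, Category.id_comp]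
  simp

theorem comp_contractLeftBy {I B : C} [BimonObj I] [BimonObj B] {i : I ⟶ B} [IsBimonHom i]
    {c : B ⟶ 𝟙_ C} (hc : i ≫ c = ε[I]) : i ≫ contractLeftBy c = i := by
  rw [contractLeftBy, IsComonHom.hom_comul_assoc, ← tensorHom_id,
    tensorHom_comp_tensorHom_assoc, hc, Category.comp_id]
  simp

/-! ### From integrals of the kernel and the cokernel to integrals along a homomorphism -/

theorem IsNormalizedIntegral.comp_comp {K A I : C} [BimonObj K] [BimonObj A] [BimonObj I]
    {t : 𝟙_ C ⟶ K} (ht : IsNormalizedIntegral t) {k : K ⟶ A} {p : A ⟶ I}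
    (h : k ≫ p = ε[K] ≫ η[I]) : (t ≫ k) ≫ p = η[I] := by
  rw [Category.assoc, h, reassoc_of% ht.normalized]

theorem IsNormalizedCointegral.comp_comp {I B Q : C} [BimonObj I] [BimonObj B] [BimonObj Q]
    {t : Q ⟶ 𝟙_ C} (ht : IsNormalizedCointegral t) {i : I ⟶ B} {q : B ⟶ Q}
    (h : i ≫ q = ε[I] ≫ η[Q]) : i ≫ q ≫ t = ε[I] := by
  rw [reassoc_of% h, ht.normalized, Category.comp_id]

/-- Since `k ≫ p` is trivial, the second leg of the comultiplication of `t` collapses to the unit.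
This supplies the hypothesis of `mulLeftBy_comul`. -/
theorem comp_comul_whiskerLeft {K A I : C} [BimonObj K] [BimonObj A] [BimonObj I]
    (t : 𝟙_ C ⟶ K) {k : K ⟶ A} [IsBimonHom k] {p : A ⟶ I} (h : k ≫ p = ε[K] ≫ η[I]) :
    (t ≫ k) ≫ Δ[A] ≫ A ◁ p = (λ_ _).inv ≫ (t ≫ k ⊗ₘ η[I]) := by
  rw [Category.assoc, IsComonHom.hom_comul_assoc, ← id_tensorHom, tensorHom_comp_tensorHom, h,
    Category.comp_id]
  conv_lhs => rw [← Category.id_comp k, ← tensorHom_comp_tensorHom]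
  rw [ComonObj.comul_counit_hom_assoc]
  simp [MonoidalCategory.tensorHom_def, unitors_inv_equal]

theorem whiskerLeft_mul_comp {I B Q : C} [BimonObj I] [BimonObj B] [BimonObj Q]
    (t : Q ⟶ 𝟙_ C) {i : I ⟶ B} {q : B ⟶ Q} [IsBimonHom q] (h : i ≫ q = ε[I] ≫ η[Q]) :
    B ◁ i ≫ μ[B] ≫ q ≫ t = (q ≫ t ⊗ₘ ε[I]) ≫ (λ_ _).hom := by
  rw [IsMonHom.mul_hom_assoc, ← id_tensorHom, tensorHom_comp_tensorHom_assoc, h,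
    Category.id_comp]
  conv_lhs => rw [← Category.comp_id q, ← tensorHom_comp_tensorHom_assoc]
  rw [MonObj.mul_one_hom_assoc]
  simp [MonoidalCategory.tensorHom_def', unitors_equal]

/-- With `s = k(t)`, the integral property gives `s k(x) a = ε(x) s a`, so multiplication by `s`
descends to the quotient of `A` by `K`. -/
theorem IsIntegral.act_comp_mulLeftBy {K A : C} [BimonObj K] [BimonObj A] {t : 𝟙_ C ⟶ K}
    (ht : IsIntegral t) (k : K ⟶ A) [IsBimonHom k] :
    (k ▷ A ≫ μ[A]) ≫ mulLeftBy (t ≫ k) = trivLeftAct K A ≫ mulLeftBy (t ≫ k) := by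
  have h : k ≫ mulLeftBy (t ≫ k) = ε[K] ≫ t ≫ k := by
    have h' := (λ_ K).inv ≫= ht.integral_mul =≫ k
    rw [Category.assoc, IsMonHom.mul_hom, ← tensorHom_id, tensorHom_comp_tensorHom_assoc] at h'
    rw [mulLeftBy, leftUnitor_inv_naturality_assoc, ← tensorHom_id, ← id_tensorHom,
      tensorHom_comp_tensorHom_assoc]
    simpa [MonoidalCategory.tensorHom_def', unitors_inv_equal] using h'
  rw [Category.assoc, mul_mulLeftBy, ← comp_whiskerRight_assoc, h, trivLeftAct, mulLeftBy]
  simp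

theorem IsCointegral.contractLeftBy_comp_coact {B Q : C} [BimonObj B] [BimonObj Q] {t : Q ⟶ 𝟙_ C}
    (ht : IsCointegral t) (q : B ⟶ Q) [IsBimonHom q] :
    contractLeftBy (q ≫ t) ≫ Δ[B] ≫ q ▷ B = contractLeftBy (q ≫ t) ≫ trivLeftCoact Q B := by
  have h : contractLeftBy (q ≫ t) ≫ q = (q ≫ t) ≫ η[Q] := by
    have h' := q ≫= ht.comul_cointegral_left =≫ (λ_ Q).hom
    rw [Category.assoc, IsComonHom.hom_comul_assoc, ← tensorHom_id,
      tensorHom_comp_tensorHom_assoc] at h'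
    rw [contractLeftBy, Category.assoc, Category.assoc, ← leftUnitor_naturality, ← tensorHom_id,
      ← id_tensorHom, tensorHom_comp_tensorHom_assoc]
    simpa [MonoidalCategory.tensorHom_def, unitors_equal] using h'
  rw [← Category.assoc, contractLeftBy_comul, Category.assoc, ← comp_whiskerRight, h, trivLeftCoact,
    contractLeftBy]
  simp

theorem exists_isNormalizedIntegralAlong {K A I B Q : C} [BimonObj K] [BimonObj A] [BimonObj I]
    [BimonObj B] [BimonObj Q] [IsCommMonObj A] [IsCommMonObj B] [IsCommComonObj A]
    [IsCommComonObj B] {k : K ⟶ A} {p : A ⟶ I} {i : I ⟶ B} {q : B ⟶ Q} {f : A ⟶ B}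
    [IsBimonHom k] [IsBimonHom p] [IsBimonHom i] [IsBimonHom q] [IsBimonHom f]
    (hf : p ≫ i = f) (hkp : k ≫ p = ε[K] ≫ η[I]) (hiq : i ≫ q = ε[I] ≫ η[Q])
    (hp : IsStableCoeq (k ▷ A ≫ μ[A]) (trivLeftAct K A) p)
    (hi : IsStableEq (Δ[B] ≫ q ▷ B) (trivLeftCoact Q B) i)
    {t : 𝟙_ C ⟶ K} (ht : IsNormalizedIntegral t) {c : Q ⟶ 𝟙_ C} (hc : IsNormalizedCointegral c) :
    ∃ m : B ⟶ A, IsNormalizedIntegralAlong f m ∧ IsGeneratorIntegralAlong f m := by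
  subst hf
  have := hp.epi_whiskerRight
  have := hi.mono_whiskerRight
  have := hp.epi
  have := hi.mono
  obtain ⟨m, hm⟩ := hp.exists_desc' _ (ht.act_comp_mulLeftBy k)
  obtain ⟨n, hn⟩ := hi.exists_lift' _ (hc.contractLeftBy_comp_coact q)
  have hm' := isRightIntegralAlong_of_comp_eq_mulLeftBy (comp_comul_whiskerLeft t hkp) hm
  have hn' := isRightIntegralAlong_of_comp_eq_contractLeftBy (whiskerLeft_mul_comp c hiq) hn
  have hs := ht.comp_comp hkp
  have hc' := hc.comp_comp hiq
  -- Normalization of `t` and of `c` enters here and in `hin`, through `hs` and `hc'`.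
  have hmp : m ≫ p = 𝟙 I := by
    rw [← cancel_epi p, reassoc_of% hm, mulLeftBy_comp hs, Category.comp_id]
  have hin : i ≫ n = 𝟙 I := by
    rw [← cancel_mono i, Category.assoc, hn, comp_contractLeftBy hc', Category.id_comp]
  have hr := hm'.comp hn'
  have hint : IsIntegralAlong (p ≫ i) (n ≫ m) := ⟨hr, hr.isLeftIntegralAlong⟩
  have hl (m' : B ⟶ A) (h : IsRightIntegralAlong (p ≫ i) m' ∨ IsLeftIntegralAlong (p ≫ i) m') :
      IsLeftIntegralAlong (p ≫ i) m' := h.elim (·.isLeftIntegralAlong) id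
  refine ⟨n ≫ m, ⟨hint, ?_⟩, hint, fun m' h => ?_, fun m' h => ?_⟩
  · simp [reassoc_of% hmp, reassoc_of% hin]
  -- As `n` retracts `i`, composing with `f` and then `n ≫ m` is multiplication by `s`. In the next
  -- case, as `m` is a section of `p`, `n ≫ m` followed by `f` is the contraction.
  · have := (hl m' h).comp_mulLeftBy (s := t ≫ k) (by
      rw [← Category.assoc, hs, IsMonHom.one_hom])
    simpa [reassoc_of% hin, hm] using this
  · have := (hl m' h).contractLeftBy_comp (c := q ≫ c) (by
      rw [Category.assoc, hc', IsComonHom.hom_counit])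
    simpa [reassoc_of% hmp, reassoc_of% hn] using this

/-! ### From integrals along a homomorphism to integrals of the kernel and the cokernel -/

/-- The element `m(1)` is coinvariant, since `f(m(1)₁) ⊗ m(1)₂ = 1 ⊗ m(1)`, so it comes from `K`. It
is an integral because `m(1) k(x) = m(f(k(x))) = ε(x) m(1)`, and likewise on the other side. -/
theorem IsNormalizedIntegralAlong.exists_isNormalizedIntegral {K A B : C} [BimonObj K]
    [BimonObj A] [BimonObj B] {k : K ⟶ A} [IsBimonHom k] {f : A ⟶ B} [IsBimonHom f] {m : B ⟶ A}
    (hm : IsNormalizedIntegralAlong f m) (hkf : k ≫ f = ε[K] ≫ η[B])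
    (hk : IsStableEq (Δ[A] ≫ f ▷ A) (trivLeftCoact B A) k) :
    ∃ t : 𝟙_ C ⟶ K, IsNormalizedIntegral t := by
  obtain ⟨t, ht⟩ := hk.exists_lift' (η[B] ≫ m) (by
    rw [Category.assoc, ← hm.left.comul, Bimon.one_comul_assoc, ← id_tensorHom,
      tensorHom_comp_tensorHom, trivLeftCoact]
    simp [MonoidalCategory.tensorHom_def'])
  have := hk.mono
  refine ⟨t, ⟨⟨?_, ?_⟩, ?_⟩⟩
  · rw [← cancel_mono k, Category.assoc, IsMonHom.mul_hom, ← tensorHom_id,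
      tensorHom_comp_tensorHom_assoc, ht, Category.id_comp]
    have h : (η[B] ≫ m ⊗ₘ k) = (η[B] ⊗ₘ k) ≫ m ▷ A := by simp [← tensorHom_id]
    rw [h, Category.assoc, hm.right.mul, ← id_tensorHom, tensorHom_comp_tensorHom_assoc, hkf]
    simp [ht, MonoidalCategory.tensorHom_def',
      unitors_equal]
  · rw [← cancel_mono k, Category.assoc, IsMonHom.mul_hom, ← id_tensorHom,
      tensorHom_comp_tensorHom_assoc, ht, Category.id_comp]
    have h : (k ⊗ₘ η[B] ≫ m) = (k ⊗ₘ η[B]) ≫ A ◁ m := by simp [← id_tensorHom]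
    rw [h, Category.assoc, hm.left.mul, ← tensorHom_id, tensorHom_comp_tensorHom_assoc, hkf]
    simp [ht, MonoidalCategory.tensorHom_def,
      unitors_equal]
  -- Writing `1` as `f(1)` exposes `f ≫ m ≫ f`: `ε(m(1)) = ε(f(m(f(1)))) = ε(f(1)) = 1`.
  · rw [← IsComonHom.hom_counit k, reassoc_of% ht, ← IsComonHom.hom_counit f,
      ← IsMonHom.one_hom_assoc f, reassoc_of% hm.normalized]
    simp

/-- The functional `m ≫ ε` is invariant, as `ε(m(f(a) b)) = ε(a m(b)) = ε(a) ε(m(b))`, so it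
descends to `Q`. -/
theorem IsNormalizedIntegralAlong.exists_isNormalizedCointegral {A B Q : C} [BimonObj A]
    [BimonObj B] [BimonObj Q] {q : B ⟶ Q} [IsBimonHom q] {f : A ⟶ B} [IsBimonHom f] {m : B ⟶ A}
    (hm : IsNormalizedIntegralAlong f m) (hfq : f ≫ q = ε[A] ≫ η[Q])
    (hq : IsStableCoeq (f ▷ B ≫ μ[B]) (trivLeftAct A B) q) :
    ∃ t : Q ⟶ 𝟙_ C, IsNormalizedCointegral t := by
  obtain ⟨t, ht⟩ := hq.exists_desc' (m ≫ ε[A]) (by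
    have := hm.left.mul
    rw [Category.assoc, ← reassoc_of% this, Bimon.mul_counit, ← id_tensorHom,
      tensorHom_comp_tensorHom_assoc, trivLeftAct]
    simp [MonoidalCategory.tensorHom_def])
  have := hq.epi
  refine ⟨t, ⟨⟨?_, ?_⟩, ?_⟩⟩
  · rw [← cancel_epi q, IsComonHom.hom_comul_assoc, ← tensorHom_id,
      tensorHom_comp_tensorHom, ht, Category.comp_id]
    have h : (m ≫ ε[A] ⊗ₘ q) = m ▷ B ≫ (ε[A] ⊗ₘ q) := by simp [← tensorHom_id]
    rw [h, reassoc_of% hm.right.comul, ← id_tensorHom, tensorHom_comp_tensorHom, hfq]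
    simp [reassoc_of% ht, MonoidalCategory.tensorHom_def,
      unitors_inv_equal]
  · rw [← cancel_epi q, IsComonHom.hom_comul_assoc, ← id_tensorHom,
      tensorHom_comp_tensorHom, ht, Category.comp_id]
    have h : (q ⊗ₘ m ≫ ε[A]) = B ◁ m ≫ (q ⊗ₘ ε[A]) := by simp [← id_tensorHom]
    rw [h, reassoc_of% hm.left.comul, ← tensorHom_id, tensorHom_comp_tensorHom, hfq]
    simp [reassoc_of% ht, MonoidalCategory.tensorHom_def',
      unitors_inv_equal]
  · rw [← IsMonHom.one_hom q, Category.assoc, ht, ← IsComonHom.hom_counit f,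
      ← IsMonHom.one_hom_assoc f, reassoc_of% hm.normalized]
    simp

theorem IsNormalizedIntegralAlong.eq_of_isGeneratorIntegralAlong {A B : C} [BimonObj A]
    [BimonObj B] {f : A ⟶ B} [IsBimonHom f] {m m₀ : B ⟶ A} (hm : IsNormalizedIntegralAlong f m)
    (hm₀ : IsGeneratorIntegralAlong f m₀) : m = m₀ := by
  have h1 := hm₀.comp_generator m (.inl hm.right)
  have h2 := hm₀.generator_comp m (.inl hm.right)
  have h3 := hm₀.comp_generator m₀ (.inl hm₀.right)
  calc m = m₀ ≫ (f ≫ m ≫ f) ≫ m₀ := by simp only [Category.assoc, h1, h2]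
    _ = m₀ := by rw [hm.normalized, h3]

end

end HopfIntegral

/-! ### The main theorem, via the coimage-image factorization. -/

open HopfIntegral in
theorem theorem202002211033 {C : Type u} [Category.{v} C] [MonoidalCategory C]
    [SymmetricCategory C] [HasEqualizers C] [HasCoequalizers C]
    (hC : HopfIntegral.IsBistable C) [Abelian (HopfIntegral.BicommHopf C)]
    (A B : HopfIntegral.BicommHopf C) (ξ : A ⟶ B) :
    ((∃ m : B.X ⟶ A.X,
        HopfIntegral.IsNormalizedIntegralAlong (HopfIntegral.BicommHopf.toHom ξ) m ∧
        HopfIntegral.IsGeneratorIntegralAlong (HopfIntegral.BicommHopf.toHom ξ) m) ↔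
      (∃ σ : 𝟙_ C ⟶ (kernel ξ).X, HopfIntegral.IsNormalizedIntegral σ) ∧
      (∃ σ : (cokernel ξ).X ⟶ 𝟙_ C, HopfIntegral.IsNormalizedCointegral σ)) ∧
    (∀ m m' : B.X ⟶ A.X,
      HopfIntegral.IsNormalizedIntegralAlong (HopfIntegral.BicommHopf.toHom ξ) m →
      HopfIntegral.IsNormalizedIntegralAlong (HopfIntegral.BicommHopf.toHom ξ) m' →
      m = m') := by
  have hto (m : B.X ⟶ A.X) (hm : IsNormalizedIntegralAlong (BicommHopf.toHom ξ) m) :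
      (∃ σ : 𝟙_ C ⟶ (kernel ξ).X, IsNormalizedIntegral σ) ∧
      (∃ σ : (cokernel ξ).X ⟶ 𝟙_ C, IsNormalizedCointegral σ) :=
    ⟨hm.exists_isNormalizedIntegral
      (by rw [← BicommHopf.toHom_comp, kernel.condition, BicommHopf.toHom_zero])
      (BicommHopf.isStableEq_kernel hC.costable ξ),
    hm.exists_isNormalizedCointegral
      (by rw [← BicommHopf.toHom_comp, cokernel.condition, BicommHopf.toHom_zero])
      (BicommHopf.isStableCoeq_cokernel hC.stable ξ)⟩
  have hfrom : (∃ σ : 𝟙_ C ⟶ (kernel ξ).X, IsNormalizedIntegral σ) ∧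
      (∃ σ : (cokernel ξ).X ⟶ 𝟙_ C, IsNormalizedCointegral σ) →
      ∃ m : B.X ⟶ A.X, IsNormalizedIntegralAlong (BicommHopf.toHom ξ) m ∧
        IsGeneratorIntegralAlong (BicommHopf.toHom ξ) m := by
    rintro ⟨⟨t, ht⟩, c, hc⟩
    -- The quotient of `A` by the kernel and the kernel of the cokernel are different objects. The
    -- coimage serves as the common middle term, with the comparison isomorphism absorbed into the
    -- inclusion.
    have := BicommHopf.isIso_toHom (Abelian.coimageImageComparison ξ)
    have hi := (BicommHopf.isStableEq_kernel hC.costable (cokernel.π ξ)).iso_comp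
      (BicommHopf.toHom (Abelian.coimageImageComparison ξ))
    rw [← BicommHopf.toHom_comp] at hi
    refine exists_isNormalizedIntegralAlong (k := BicommHopf.toHom (kernel.ι ξ))
      (q := BicommHopf.toHom (cokernel.π ξ)) ?_ ?_ ?_
      (BicommHopf.isStableCoeq_cokernel hC.stable (kernel.ι ξ)) hi ht hc
    · rw [← BicommHopf.toHom_comp]
      exact congrArg _ (Abelian.coimage_image_factorisation ξ)
    · rw [← BicommHopf.toHom_comp, cokernel.condition, BicommHopf.toHom_zero]
    · rw [← BicommHopf.toHom_comp, Category.assoc, kernel.condition, comp_zero,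
        BicommHopf.toHom_zero]
  refine ⟨⟨fun ⟨m, hm, _⟩ => hto m hm, hfrom⟩, fun m m' hm hm' => ?_⟩
  -- One normalized integral already provides a generator `m₀`, and every normalized integral equals
  -- it.
  obtain ⟨m₀, -, hm₀⟩ := hfrom (hto m hm)
  rw [hm.eq_of_isGeneratorIntegralAlong hm₀, hm'.eq_of_isGeneratorIntegralAlong hm₀]
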